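/- **Conventions.** Let $\sigma$ be a relational signature. A *structure* is a finite $\sigma$-structure $\mathbf A$, with domain $A$, endowed with a probability measure $\nu_{\mathbf A}$ on $A$. Distances are taken in the Gaifman graph of $\mathbf A$ (two distinct elements are adjacent if they occur together in a tuple of some relation); $B^d_{\mathbf A}(X)$ is the set of elements at distance at most $d$ from $X\subseteq A$, and $\partial_{\mathbf A}X=B^1_{\mathbf A}(X)\setminus X$. A first-order formula $\phi(x_1,\dots,x_p)$ is *local* if there is $r\in\mathbb N$ such that, for every structure $\mathbf A$ and all $v_1,\dots,v_p\in A$, $\mathbf A\models\phi(v_1,\dots,v_p)$ if and only if the substructure of $\mathbf A$ induced by $B^r_{\mathbf A}(\{v_1,\dots,v_p\})$ satisfies $\phi(v_1,\dots,v_p)$. Put $\langle\phi,\mathbf A\rangle=\nu_{\mathbf A}^{\otimes p}(\{(v_1,\dots,v_p)\in A^p:\mathbf A\models\phi(v_1,\dots,v_p)\})$. A sequence $\mathsf A=(\mathbf A_n)_{n\in\mathbb N}$ of structures is *local-convergent* if $\langle\phi,\mathbf A_n\rangle$ converges as $n\to\infty$ for every local formula $\phi$. A sequence $\mathsf X=(X_n)$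 with $X_n\subseteq A_n$ is *negligible* in $\mathsf A$ if $\nu_{\mathbf A_n}(B^d_{\mathbf A_n}(X_n))\to0$ for every $d\in\mathbb N$; $\mathsf X\approx\mathsf Y$ means that $(X_n\,\Delta\,Y_n)$ is negligible. $\mathsf X$ is a *cluster* of $\mathsf A$ if the sequence obtained by marking the elements of each $X_n$ by one new unary relation is local-convergent and $(\partial_{\mathbf A_n}X_n)$ is negligible. Clusters $\mathsf X,\mathsf Y$ are *strongly disjoint* if $B^1_{\mathbf A_n}(X_n)\cap Y_n=X_n\cap B^1_{\mathbf A_n}(Y_n)=\emptyset$ for all $n$. A *clustering* of a local-convergent sequence $\mathsf A$ by the marks $M_0,M_1,\dots$ is a sequence $\mathsf A^+$ obtained by interpreting new unary relations $M_0,M_1,\dots$ in each $\mathbf A_n$, as sets $M_i(\mathbf A_n)\subseteq A_n$, such that, with $S_n=A_n\setminus\bigcup_iM_i(\mathbf A_n)$: 1. $\mathsf A^+$ is local-convergent (as a sequence of structures over $\sigma\cup\{M_0,M_1,\dots\}$); 2. $(S_n)$ is negligible, and $\bigcup_i\partial_{\mathbf A_n}M_i(\mathbf A_n)\subseteq S_n$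 for every $n$; 3. for every $n$, the nonempty sets among $S_n,M_0(\mathbf A_n),M_1(\mathbf A_n),\dots$ form a partition of $A_n$; 4. $\sum_i\lim_n\nu_{\mathbf A_n}(M_i(\mathbf A_n))=\lim_n\sum_i\nu_{\mathbf A_n}(M_i(\mathbf A_n))=1$, where all these limits exist. **Lemma (Cluster Comb Lemma).** Let $\mathsf A$ be a local-convergent sequence of $\sigma$-structures, and let $\mathsf C^1,\mathsf C^2,\dots$ be countably many pairwise strongly disjoint clusters of $\mathsf A$. Then there exist a clustering $\mathsf A^+$ of $\mathsf A$ by marks $M_0,M_1,M_2,\dots$ and a non-decreasing function $G:\mathbb N\to\mathbb N$ with $\lim_{i\to\infty}G(i)=\infty$ such that, for every $i\ge1$ and every $n\in\mathbb N$, $$M_i(\mathbf A_n)=\begin{cases}C^i_n&\text{if }n\ge G(i),\\ \emptyset&\text{otherwise.}\end{cases}$$ In particular, $(M_i(\mathbf A_n))_{n\in\mathbb N}\approx\mathsf C^i$ for every $i\ge1$, and the marked sequence $\mathsf A^+$ is local-convergent. -/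

import Mathlib

open MeasureTheory Filter Topology

universe u v w

namespace ClusterComb

/-- A finite `L`-structure endowed with a probability measure on its domain
(every subset of the domain is measurable). -/
structure ProbStr (L : FirstOrder.Language.{u, v}) where
  /-- the domain -/
  carrier : Type w
  [str : L.Structure carrier]
  [fin : Finite carrier]
  [meas : MeasurableSpace carrier]
  [disc : DiscreteMeasurableSpace carrier]
  /-- the probability measure on the domain -/
  ν : Measure carrier
  [prob : IsProbabilityMeasure ν]

attribute [instance] ProbStr.str ProbStr.fin ProbStr.meas ProbStr.disc ProbStr.prob

/-- The Gaifman graph of a structure: two distinct elements are adjacent when they occur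
together in some tuple of some relation. -/
def gaifman (L : FirstOrder.Language.{u, v}) (A : Type w) [L.Structure A] : SimpleGraph A where
  Adj a b := a ≠ b ∧ ∃ (k : ℕ) (R : L.Relations k) (t : Fin k → A),
    FirstOrder.Language.Structure.RelMap R t ∧ a ∈ Set.range t ∧ b ∈ Set.range t
  symm := ⟨fun _ _ h => by
    obtain ⟨hne, k, R, t, hR, ha, hb⟩ := h
    exact ⟨hne.symm, k, R, t, hR, hb, ha⟩⟩
  loopless := ⟨fun _ h => h.1 rfl⟩

/-- The closed `d`-neighbourhood of `X`: all elements at (Gaifman) distance at most `d` from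
some element of `X`. -/
def ball (L : FirstOrder.Language.{u, v}) {A : Type w} [L.Structure A] (d : ℕ) (X : Set A) : Set A :=
  {a | ∃ x ∈ X, (gaifman L A).edist x a ≤ (d : ℕ∞)}

/-- The outer boundary of `X`. -/
def boundary (L : FirstOrder.Language.{u, v}) {A : Type w} [L.Structure A] (X : Set A) : Set A :=
  ball L 1 X \ X

theorem subset_ball (L : FirstOrder.Language.{u, v}) {A : Type w} [L.Structure A] (d : ℕ) (X : Set A) :
    X ⊆ ball L d X :=
  fun x hx => ⟨x, hx, by simp⟩

/-- The substructure of a relational structure induced by an arbitrary subset. -/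
def induced (L : FirstOrder.Language.{u, v}) [L.IsRelational] {A : Type w} [L.Structure A] (X : Set A) :
    L.Substructure A where
  carrier := X
  fun_mem f := isEmptyElim f

/-- `φ(x₁, …, x_p)` is `r`-local: its satisfaction at `v₁, …, v_p` in a finite structure only
depends on the substructure induced by the `r`-neighbourhood of `{v₁, …, v_p}`. -/
def IsRLocal {L : FirstOrder.Language.{u, v}} [L.IsRelational] {p : ℕ} (r : ℕ) (φ : L.Formula (Fin p)) :
    Prop :=
  ∀ (A : Type w) [Finite A] [L.Structure A] (a : Fin p → A),
    φ.Realize a ↔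
      φ.Realize (M := induced L (ball L r (Set.range a)))
        (fun i => ⟨a i, subset_ball L r _ (Set.mem_range_self i)⟩)

/-- `φ` is local if it is `r`-local for some `r`. -/
def IsLocal {L : FirstOrder.Language.{u, v}} [L.IsRelational] {p : ℕ} (φ : L.Formula (Fin p)) : Prop :=
  ∃ r : ℕ, IsRLocal.{u, v, w} r φ

/-- The Stone pairing `⟨φ, A⟩`: the measure of the satisfaction set of `φ` for the `p`-fold
product measure. -/
noncomputable def stone {L : FirstOrder.Language.{u, v}} {p : ℕ} (φ : L.Formula (Fin p))
    (A : ProbStr.{u, v, w} L) : ℝ :=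
  (Measure.pi fun _ : Fin p => A.ν).real {a | φ.Realize a}

/-- A sequence of structures is local-convergent if `⟨φ, A_n⟩` converges for every local
formula `φ`. -/
def LocalConvergent {L : FirstOrder.Language.{u, v}} [L.IsRelational] (A : ℕ → ProbStr.{u, v, w} L) : Prop :=
  ∀ (p : ℕ) (φ : L.Formula (Fin p)), IsLocal.{u, v, w} φ →
    ∃ l : ℝ, Tendsto (fun n => stone φ (A n)) atTop (𝓝 l)

/-- The relation symbols of the signature of marks: one unary symbol for every `i : ι`. -/
inductive MarkRel (ι : Type) : ℕ → Type
  | mark (i : ι) : MarkRel ι 1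

/-- The signature consisting of unary relation symbols `M_i`, `i : ι`. -/
abbrev markLang (ι : Type) : FirstOrder.Language.{0, 0} where
  Functions _ := Empty
  Relations := MarkRel ι

instance (ι : Type) : (markLang ι).IsRelational :=
  fun _ => inferInstanceAs (IsEmpty Empty)

/-- The interpretation of the marks given by a family of subsets: `M_i(a)` iff `a ∈ X i`. -/
@[reducible]
def markStructure {ι : Type} {A : Type w} (X : ι → Set A) : (markLang ι).Structure A where
  funMap f := isEmptyElim f
  RelMap R t :=
    match R, t with
    | MarkRel.mark i, t => t 0 ∈ X i

/-- The lift of `A` obtained by marking the elements of `X i` by `M_i`, for each `i`. -/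
abbrev ProbStr.lift {L : FirstOrder.Language.{u, v}} {ι : Type} (A : ProbStr.{u, v, w} L)
    (X : ι → Set A.carrier) : ProbStr.{u, v, w} (L.sum (markLang ι)) where
  carrier := A.carrier
  str := letI := markStructure X; inferInstance
  ν := A.ν

/-- Sequences `(X_n)` of subsets `X_n ⊆ A_n`. -/
abbrev SubsetSeq {L : FirstOrder.Language.{u, v}} (A : ℕ → ProbStr.{u, v, w} L) : Type w :=
  (n : ℕ) → Set (A n).carrier

/-- `X` is negligible in `A`: for every `d`, the measure of the `d`-neighbourhood of `X_n`
tends to `0`. -/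
def Negligible {L : FirstOrder.Language.{u, v}} (A : ℕ → ProbStr.{u, v, w} L) (X : SubsetSeq A) : Prop :=
  ∀ d : ℕ, Tendsto (fun n => (A n).ν (ball L d (X n))) atTop (𝓝 0)

/-- `X ≈ Y`: the sequence of symmetric differences is negligible. -/
def Equivalent {L : FirstOrder.Language.{u, v}} (A : ℕ → ProbStr.{u, v, w} L) (X Y : SubsetSeq A) : Prop :=
  Negligible A fun n => symmDiff (X n) (Y n)

/-- `X` is a cluster of `A`: marking `X` (by a single new unary relation) gives a
local-convergent sequence, and the outer boundary of `X` is negligible. -/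
def IsCluster {L : FirstOrder.Language.{u, v}} [L.IsRelational] (A : ℕ → ProbStr.{u, v, w} L)
    (X : SubsetSeq A) : Prop :=
  LocalConvergent (fun n => (A n).lift (fun _ : Unit => X n)) ∧
    Negligible A fun n => boundary L (X n)

/-- `X` and `Y` are strongly disjoint. -/
def StronglyDisjoint {L : FirstOrder.Language.{u, v}} (A : ℕ → ProbStr.{u, v, w} L) (X Y : SubsetSeq A) :
    Prop :=
  ∀ n, (ball L 1 (X n) ∩ Y n) ∪ (X n ∩ ball L 1 (Y n)) = ∅

/-- The sequence `S = A \ ⋃ᵢ Mᵢ(A)` of sets of unmarked elements. -/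
def unmarked {L : FirstOrder.Language.{u, v}} (A : ℕ → ProbStr.{u, v, w} L) (M : ℕ → SubsetSeq A) :
    SubsetSeq A :=
  fun n => (⋃ i, M i n)ᶜ

/-- The lift of `A` by the unary marks `M_0, M_1, …` is a clustering of `A`. -/
structure IsClustering {L : FirstOrder.Language.{u, v}} [L.IsRelational] (A : ℕ → ProbStr.{u, v, w} L)
    (M : ℕ → SubsetSeq A) : Prop where
  /-- the marked sequence is local-convergent -/
  localConvergent : LocalConvergent fun n => (A n).lift fun i => M i n
  /-- the sequence of sets of unmarked elements is negligible -/
  negligible : Negligible A (unmarked A M)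
  /-- the outer boundaries of the marked sets are unmarked -/
  boundary_subset : ∀ n, (⋃ i, boundary L (M i n)) ⊆ unmarked A M n
  /-- the nonempty sets among the marked sets and the set of unmarked elements form a partition
  of the domain (that they cover it, and that the unmarked part is disjoint from the marked
  sets, holds by definition of the unmarked part) -/
  partition : ∀ n, Pairwise fun i j => Disjoint (M i n) (M j n)
  /-- stability: `∑ᵢ limₙ ν(Mᵢ) = limₙ ∑ᵢ ν(Mᵢ) = 1`, where all the limits exist -/
  stable : ∃ l : ℕ → ENNReal,
    (∀ i, Tendsto (fun n => (A n).ν (M i n)) atTop (𝓝 (l i))) ∧ ∑' i, l i = 1 ∧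
      Tendsto (fun n => ∑' i, (A n).ν (M i n)) atTop (𝓝 1)

end ClusterComb

namespace ClusterComb

open FirstOrder FirstOrder.Language

/-! ### Balls in the Gaifman graph. -/

section Graph

variable {L : FirstOrder.Language.{u, v}} {A : Type w} [L.Structure A]

/-! Each cluster is kept empty until an index from which its measure is at most its limit `l j` plus
`2⁻ʲ` and the ball of radius `j` around its boundary has measure at most `2⁻ʲ`. Disjointness gives
`∑ l j ≤ 1`, so both families of bounds are summable. The mark `M_0` is the complement of the closed
neighbourhood of all truncated clusters; strong disjointness then makes the unmarked set exactly the
union of their boundaries (`unmarked_combMarks`). Dominated convergence for series yields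
negligibility of that set and stability of the masses.

The hard point is local convergence with infinitely many marks. A formula uses finitely many of
them, so for large `m` one compares the marking with the finite partition into the first `m`
clusters and a remainder. By locality and a Feferman-Vaught argument (`decomposable`,
`IsRLocal.decompose`), on tuples far from the boundaries the formula is a Boolean combination of
local formulas about the separate parts; by Fubini its measure is, up to a vanishing error, a finite
sum of products of statistics of the parts.

These statistics converge on clusters by definition. On the remainder they converge by subtraction
from the statistics of the whole structure, with induction on the number of variables
(`convergesOn_of_forall_ne`). The remainder differs from `M_0` only on the unmarked set and on the
later clusters, whose total mass is uniformly small. Each Stone pairing is therefore eventually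
within `ε` of a convergent sequence, for every `ε`, and so converges. -/

theorem edist_le_succ_iff {V : Type*} (G : SimpleGraph V) (x a : V) (d : ℕ) :
    G.edist x a ≤ ((d + 1 : ℕ) : ℕ∞) ↔ ∃ z, G.edist x z ≤ (d : ℕ∞) ∧ (z = a ∨ G.Adj z a) := by
  constructor
  · intro h
    have hne : G.edist x a ≠ ⊤ := fun h' => by
      rw [h'] at h; exact absurd h (by simp)
    obtain ⟨p, hp⟩ := G.exists_walk_of_edist_ne_top hne
    rw [← hp] at h
    have h : p.length ≤ d + 1 := by exact_mod_cast h
    by_cases hd : p.length ≤ d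
    · exact ⟨a, (G.edist_le p).trans (by exact_mod_cast hd), Or.inl rfl⟩
    · have hnil : ¬ p.Nil := by
        intro hn
        rw [← SimpleGraph.Walk.length_eq_zero_iff] at hn
        omega
      refine ⟨p.penultimate, (G.edist_le p.dropLast).trans ?_, Or.inr (p.adj_penultimate hnil)⟩
      have : p.dropLast.length ≤ d := by
        rw [SimpleGraph.Walk.length_dropLast]; omega
      exact_mod_cast this
  · rintro ⟨z, hz, rfl | hz'⟩
    · exact hz.trans (by exact_mod_cast Nat.le_succ d)
    · refine (G.edist_triangle (v := z)).trans ?_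
      rw [SimpleGraph.edist_eq_one_iff_adj.2 hz']
      push_cast
      gcongr

theorem ball_zero (X : Set A) : ball L 0 X = X := by
  ext a
  simp [ball]

theorem mem_ball_succ {d : ℕ} {X : Set A} {a : A} :
    a ∈ ball L (d + 1) X ↔ ∃ z ∈ ball L d X, z = a ∨ (gaifman L A).Adj z a := by
  simp only [ball, Set.mem_ofPred_eq, edist_le_succ_iff]
  grind

theorem ball_mono_radius {d e : ℕ} (h : d ≤ e) (X : Set A) : ball L d X ⊆ ball L e X := by
  rintro a ⟨x, hx, ha⟩
  exact ⟨x, hx, ha.trans (by exact_mod_cast h)⟩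

theorem ball_mono {d : ℕ} {X Y : Set A} (h : X ⊆ Y) : ball L d X ⊆ ball L d Y := by
  rintro a ⟨x, hx, ha⟩
  exact ⟨x, h hx, ha⟩

theorem ball_iUnion {ι : Sort*} (d : ℕ) (X : ι → Set A) :
    ball L d (⋃ i, X i) = ⋃ i, ball L d (X i) := by
  ext a
  simp only [ball, Set.mem_iUnion, Set.mem_ofPred_eq]
  grind

theorem ball_union (d : ℕ) (X Y : Set A) : ball L d (X ∪ Y) = ball L d X ∪ ball L d Y := by
  ext a
  simp only [ball, Set.mem_union, Set.mem_ofPred_eq]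
  grind

theorem ball_ball_subset (d e : ℕ) (X : Set A) : ball L d (ball L e X) ⊆ ball L (d + e) X := by
  rintro a ⟨y, ⟨x, hx, hy⟩, ha⟩
  refine ⟨x, hx, ((gaifman L A).edist_triangle (v := y)).trans ?_⟩
  rw [add_comm d e]
  push_cast
  exact add_le_add hy ha

theorem mem_ball_singleton {d : ℕ} {x a : A} :
    a ∈ ball L d {x} ↔ (gaifman L A).edist x a ≤ d := by
  simp [ball]

theorem mem_ball_singleton_comm {d : ℕ} {x a : A} :
    x ∈ ball L d {a} ↔ a ∈ ball L d {x} := by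
  rw [mem_ball_singleton, mem_ball_singleton, SimpleGraph.edist_comm]

theorem mem_ball_iff_exists {d : ℕ} {X : Set A} {a : A} :
    a ∈ ball L d X ↔ ∃ x ∈ X, x ∈ ball L d {a} := by
  simp only [mem_ball_singleton_comm (a := a)]
  simp [ball]

theorem ball_range_eq {V : Type*} (d : ℕ) (x : V → A) :
    ball L d (Set.range x) = ⋃ i, ball L d {x i} := by
  rw [← ball_iUnion]
  congr 1
  ext a
  simp [eq_comm]

theorem gaifman_adj_of_relMap {k : ℕ} {R : L.Relations k} {t : Fin k → A}
    (h : Structure.RelMap R t) (i j : Fin k) : t i = t j ∨ (gaifman L A).Adj (t i) (t j) := by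
  by_cases hij : t i = t j
  · exact Or.inl hij
  · exact Or.inr ⟨hij, k, R, t, h, ⟨i, rfl⟩, ⟨j, rfl⟩⟩

theorem mem_ball_succ_of_relMap {d k : ℕ} {X : Set A} {R : L.Relations k} {t : Fin k → A}
    (h : Structure.RelMap R t) {i : Fin k} (hi : t i ∈ ball L d X) (j : Fin k) :
    t j ∈ ball L (d + 1) X :=
  mem_ball_succ.2 ⟨t i, hi, gaifman_adj_of_relMap h i j⟩

/-- A ball around a point of `X` that leaves `X` meets the boundary of `X`. -/
theorem mem_ball_boundary {d : ℕ} {X : Set A} {x y : A} (hx : x ∈ X) (hy : y ∉ X)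
    (h : y ∈ ball L d {x}) : x ∈ ball L d (boundary L X) := by
  induction d generalizing y with
  | zero =>
    rw [ball_zero] at h
    exact absurd (Set.mem_singleton_iff.1 h ▸ hx) hy
  | succ d ih =>
    obtain ⟨z, hz, hzy⟩ := mem_ball_succ.1 h
    -- The last step of the path either crosses out of `X`, which puts `y` in the boundary, or
    -- starts at a point `z` outside `X` that is already closer to `x`.
    by_cases hzX : z ∈ X
    · have : y ∈ boundary L X :=
        ⟨mem_ball_succ.2 ⟨z, by rwa [ball_zero], hzy⟩, hy⟩
      exact mem_ball_iff_exists.2 ⟨y, this, h⟩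
    · exact ball_mono_radius (Nat.le_succ d) _ (ih hzX hz)

end Graph

/-! ### Relativisation and locality in relational languages. -/

section Relational

variable {L : FirstOrder.Language.{u, v}} {α : Type*}

/-- The relation symbols occurring in a formula. -/
def rels : ∀ {n : ℕ}, L.BoundedFormula α n → Set (Σ k, L.Relations k)
  | _, .falsum => ∅
  | _, .equal _ _ => ∅
  | _, .rel R _ => {⟨_, R⟩}
  | _, .imp φ ψ => rels φ ∪ rels ψ
  | _, .all φ => rels φ

theorem rels_finite {n : ℕ} (φ : L.BoundedFormula α n) : (rels φ).Finite := by
  induction φ with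
  | falsum => exact Set.finite_empty
  | equal => exact Set.finite_empty
  | rel => exact Set.finite_singleton _
  | imp _ _ h₁ h₂ => exact h₁.union h₂
  | all _ h => exact h

theorem exists_eq_var [L.IsRelational] (t : L.Term α) : ∃ a, t = Term.var a := by
  cases t with
  | var a => exact ⟨a, rfl⟩
  | func f => exact isEmptyElim f

/-- A bijection that respects the relation symbols occurring in `φ` respects satisfaction
of `φ`. -/
theorem realize_iff_of_rels [L.IsRelational] {M N : Type*} [L.Structure M] [L.Structure N] (e : M ≃ N) {n : ℕ}
    (φ : L.BoundedFormula α n)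
    (h : ∀ k (R : L.Relations k), ⟨k, R⟩ ∈ rels φ → ∀ t : Fin k → M,
      Structure.RelMap R (e ∘ t) ↔ Structure.RelMap R t) (v : α → M) (xs : Fin n → M) :
    φ.Realize (e ∘ v) (e ∘ xs) ↔ φ.Realize v xs := by
  have hterm : ∀ {n : ℕ} (xs : Fin n → M) (t : L.Term (α ⊕ Fin n)),
      t.realize (Sum.elim (e ∘ v) (e ∘ xs)) = e (t.realize (Sum.elim v xs)) := by
    intro n xs t
    obtain ⟨a, rfl⟩ := exists_eq_var t
    rcases a with a | a <;> rfl
  induction φ with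
  | falsum => rfl
  | equal t₁ t₂ => simp [BoundedFormula.Realize, hterm]
  | rel R ts =>
    simp only [BoundedFormula.Realize, hterm]
    exact h _ R rfl _
  | imp φ ψ h₁ h₂ =>
    simp only [BoundedFormula.realize_imp]
    exact imp_congr (h₁ (fun k R hR => h k R (Or.inl hR)) xs)
      (h₂ (fun k R hR => h k R (Or.inr hR)) xs)
  | all φ ih =>
    simp only [BoundedFormula.realize_all]
    rw [← e.forall_congr_right]
    refine forall_congr' fun a => ?_
    have := ih h (Fin.snoc xs a)
    rwa [Fin.comp_snoc] at this

/-- Satisfaction of a formula with all quantifiers restricted to `U`. -/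
def RealizeOn {M : Type*} [L.Structure M] (U : Set M) :
    ∀ {n : ℕ}, L.BoundedFormula α n → (α → M) → (Fin n → M) → Prop
  | _, .falsum, _, _ => False
  | _, .equal t₁ t₂, v, xs => t₁.realize (Sum.elim v xs) = t₂.realize (Sum.elim v xs)
  | _, .rel R ts, v, xs => Structure.RelMap R fun i => (ts i).realize (Sum.elim v xs)
  | _, .imp φ ψ, v, xs => RealizeOn U φ v xs → RealizeOn U ψ v xs
  | _, .all φ, v, xs => ∀ y ∈ U, RealizeOn U φ v (Fin.snoc xs y)

theorem realizeOn_univ {M : Type*} [L.Structure M] {n : ℕ} (φ : L.BoundedFormula α n)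
    (v : α → M) (xs : Fin n → M) : RealizeOn Set.univ φ v xs ↔ φ.Realize v xs := by
  induction φ with
  | falsum => rfl
  | equal => rfl
  | rel => rfl
  | imp φ ψ h₁ h₂ => simp only [RealizeOn, BoundedFormula.Realize, h₁, h₂]
  | all φ ih => simp only [RealizeOn, BoundedFormula.Realize, ih, Set.mem_univ, true_imp_iff]

theorem realizeOn_image [L.IsRelational] {M N : Type*} [L.Structure M] [L.Structure N] (e : M ↪[L] N) (U : Set M)
    {n : ℕ} (φ : L.BoundedFormula α n) (v : α → M) (xs : Fin n → M) :
    RealizeOn (e '' U) φ (e ∘ v) (e ∘ xs) ↔ RealizeOn U φ v xs := by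
  have hterm : ∀ {n : ℕ} (xs : Fin n → M) (t : L.Term (α ⊕ Fin n)),
      t.realize (Sum.elim (e ∘ v) (e ∘ xs)) = e (t.realize (Sum.elim v xs)) := by
    intro n xs t
    obtain ⟨a, rfl⟩ := exists_eq_var t
    rcases a with a | a <;> rfl
  induction φ with
  | falsum => rfl
  | equal t₁ t₂ => simp [RealizeOn, hterm, e.injective.eq_iff]
  | rel R ts =>
    simp only [RealizeOn, hterm]
    exact e.map_rel R _
  | imp φ ψ h₁ h₂ => simp only [RealizeOn, h₁, h₂]
  | all φ ih =>
    simp only [RealizeOn, Set.forall_mem_image]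
    refine forall₂_congr fun a _ => ?_
    have := ih (Fin.snoc xs a)
    rwa [Fin.comp_snoc] at this

/-- Trades satisfaction in a subtype for quantifiers bounded by a set of the ambient structure, so
that substructures can be compared through their underlying sets alone. -/
theorem realize_substructure_iff [L.IsRelational] {M : Type*} [L.Structure M] (S : L.Substructure M) {n : ℕ}
    (φ : L.BoundedFormula α n) (v : α → S) (xs : Fin n → S) :
    φ.Realize v xs ↔ RealizeOn (S : Set M) φ (fun a => (v a : M)) fun i => (xs i : M) := by
  rw [← realizeOn_univ, ← realizeOn_image S.subtype]
  simp only [Set.image_univ]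
  have : Set.range S.subtype = (S : Set M) := by simp
  rw [this]
  rfl

/-- The relativisation of a formula to the set defined by `D`. -/
def relativize (D : L.Formula (α ⊕ Unit)) : ∀ {n : ℕ}, L.BoundedFormula α n → L.BoundedFormula α n
  | _, .falsum => .falsum
  | _, .equal t₁ t₂ => .equal t₁ t₂
  | _, .rel R ts => .rel R ts
  | _, .imp φ ψ => .imp (relativize D φ) (relativize D ψ)
  -- The distinguished variable of the guard `D` is sent to the variable just quantified; the
  -- parameters of `D` stay the free variables.
  | n, .all φ => .all (.imp
      (BoundedFormula.relabel (n := n + 1) (k := 0)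
        (Sum.elim Sum.inl fun _ => Sum.inr (Fin.last n)) D) (relativize D φ))

theorem realize_relativize {M : Type*} [L.Structure M] (D : L.Formula (α ⊕ Unit)) {n : ℕ}
    (φ : L.BoundedFormula α n) (v : α → M) (xs : Fin n → M) :
    (relativize D φ).Realize v xs ↔
      RealizeOn {y | D.Realize (Sum.elim v fun _ => y)} φ v xs := by
  induction φ with
  | falsum => rfl
  | equal => rfl
  | rel => rfl
  | imp φ ψ h₁ h₂ => simp only [relativize, RealizeOn, BoundedFormula.Realize, h₁, h₂]
  | all φ ih =>
    simp only [relativize, RealizeOn, BoundedFormula.Realize, ih, Set.mem_ofPred_eq]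
    refine forall_congr' fun a => imp_congr ?_ Iff.rfl
    refine (BoundedFormula.realize_relabel (φ := D)).trans ?_
    rw [Formula.Realize]
    convert Iff.rfl using 2
    · ext i
      rcases i with i | i <;> simp

/-- The structure in which the relations not in `F` are made empty. -/
@[reducible]
def restrictRel (F : Set (Σ k, L.Relations k)) (M : Type*) [L.Structure M] : L.Structure M where
  funMap f := Structure.funMap f
  RelMap {k} R t := ⟨k, R⟩ ∈ F ∧ Structure.RelMap R t

/-- The ball with respect to the relations in `F`. -/
def ballOn (F : Set (Σ k, L.Relations k)) {M : Type*} [L.Structure M] (d : ℕ) (X : Set M) : Set M :=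
  @ball L M (restrictRel F M) d X

/-- Finiteness of `F` makes the disjunction over relation symbols a first-order formula. For an
infinite signature full Gaifman adjacency need not be definable, which is why balls are taken with
respect to `F`. -/
theorem exists_adj_formula {F : Set (Σ k, L.Relations k)} (hF : F.Finite) :
    ∃ φ : L.Formula Bool, ∀ (M : Type w) [L.Structure M] (x : Bool → M),
      φ.Realize x ↔ (@gaifman L M (restrictRel F M)).Adj (x true) (x false) := by
  have := hF.to_subtype
  refine ⟨(Term.equal (Term.var true) (Term.var false)).not ⊓ Formula.iSup fun R : F =>
    Formula.iExs (Fin R.1.1) (Relations.formula R.1.2 (fun i => Term.var (Sum.inr i)) ⊓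
      ((Formula.iSup fun i : Fin R.1.1 =>
        Term.equal (Term.var (Sum.inr i)) (Term.var (Sum.inl true))) ⊓
      (Formula.iSup fun i : Fin R.1.1 =>
        Term.equal (Term.var (Sum.inr i)) (Term.var (Sum.inl false))))), ?_⟩
  intro M _ x
  simp only [Formula.realize_inf, Formula.realize_not, Formula.realize_equal, Term.realize_var,
    Formula.realize_iSup, Formula.realize_iExs, Formula.realize_rel, gaifman, Sum.elim_inl,
    Sum.elim_inr, Set.mem_range]
  constructor
  · rintro ⟨hne, ⟨⟨k, R⟩, hR⟩, t, ht, h₁, h₂⟩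
    exact ⟨hne, k, R, t, ⟨hR, ht⟩, h₁, h₂⟩
  · rintro ⟨hne, k, R, t, ⟨hR, ht⟩, h₁, h₂⟩
    exact ⟨hne, ⟨⟨k, R⟩, hR⟩, t, ht, h₁, h₂⟩

theorem exists_ball_formula {α : Type} [Finite α] {F : Set (Σ k, L.Relations k)} (hF : F.Finite)
    (d : ℕ) :
    ∃ D : L.Formula (α ⊕ Unit), ∀ (M : Type w) [L.Structure M] (x : α → M) (y : M),
      D.Realize (Sum.elim x fun _ => y) ↔ y ∈ ballOn F d (Set.range x) := by
  induction d with
  | zero =>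
    refine ⟨Formula.iSup fun i : α => Term.equal (Term.var (Sum.inl i)) (Term.var (Sum.inr ())), ?_⟩
    intro M _ x y
    simp [Formula.realize_iSup, Formula.realize_equal, ballOn, ball_zero]
  | succ d ih =>
    obtain ⟨D, hD⟩ := ih
    obtain ⟨φ, hφ⟩ := exists_adj_formula.{u, v, w} hF
    refine ⟨Formula.iExs Unit (D.relabel (Sum.map Sum.inl id) ⊓
      (Term.equal (Term.var (Sum.inr ())) (Term.var (Sum.inl (Sum.inr ()))) ⊔
        φ.relabel (fun b => cond b (Sum.inr ()) (Sum.inl (Sum.inr ()))))), ?_⟩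
    intro M _ x y
    have h1 : ∀ i : Unit → M, Sum.elim (Sum.elim x fun _ : Unit => y) i ∘
        Sum.map (Sum.inl : α → α ⊕ Unit) (id : Unit → Unit) = Sum.elim x (fun _ => i ()) := by
      intro i; ext a; rcases a with a | a <;> rfl
    simp only [Formula.realize_iExs, Formula.realize_inf, Formula.realize_sup,
      Formula.realize_equal, Formula.realize_relabel, h1, hD, hφ, Term.realize_var, Sum.elim_inl,
      Sum.elim_inr, Function.comp_apply, cond_true, cond_false]
    refine Iff.trans ?_ (@mem_ball_succ L M (restrictRel F M) d (Set.range x) y).symm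
    constructor
    · rintro ⟨i, h, h'⟩
      exact ⟨i (), h, h'⟩
    · rintro ⟨i, h, h'⟩
      exact ⟨fun _ => i, h, h'⟩

theorem gaifman_restrictRel_le (F : Set (Σ k, L.Relations k)) (M : Type*) [L.Structure M] :
    @gaifman L M (restrictRel F M) ≤ gaifman L M := by
  rintro a b ⟨hne, k, R, t, ⟨-, ht⟩, h⟩
  exact ⟨hne, k, R, t, ht, h⟩

theorem ballOn_subset_ball (F : Set (Σ k, L.Relations k)) {M : Type*} [L.Structure M] (d : ℕ)
    (X : Set M) : ballOn F d X ⊆ ball L d X := by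
  rintro a ⟨x, hx, h⟩
  exact ⟨x, hx, (SimpleGraph.edist_anti (gaifman_restrictRel_le F M)).trans h⟩

/-- Balls of radius at most `r` do not change when passing to a substructure containing the ball
of radius `r`. -/
theorem image_ballOn_substructure (F : Set (Σ k, L.Relations k)) {M : Type*} [L.Structure M]
    (S : L.Substructure M) (X : Set S) {r d : ℕ} (hd : d ≤ r)
    (hS : ballOn F r ((↑) '' X) ⊆ (S : Set M)) :
    ((↑) : S → M) '' ballOn F d X = ballOn F d ((↑) '' X) := by
  induction d with
  | zero => simp only [ballOn, @ball_zero L]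
  | succ d ih =>
    have ih := ih (by omega)
    ext a
    constructor
    · rintro ⟨a, ha, rfl⟩
      obtain ⟨z, hz, hza⟩ := (@mem_ball_succ L S (restrictRel F S) _ _ _).1 ha
      have hz : (z : M) ∈ ballOn F d ((↑) '' X) := by rw [← ih]; exact ⟨z, hz, rfl⟩
      refine (@mem_ball_succ L M (restrictRel F M) _ _ _).2 ⟨z, hz, ?_⟩
      rcases hza with rfl | ⟨hne, k, R, t, ⟨hR, ht⟩, h₁, h₂⟩
      · exact Or.inl rfl
      · refine Or.inr ⟨fun h => hne (Subtype.ext h), k, R, fun i => t i, ⟨hR, ht⟩, ?_, ?_⟩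
        · obtain ⟨i, rfl⟩ := h₁; exact ⟨i, rfl⟩
        · obtain ⟨i, rfl⟩ := h₂; exact ⟨i, rfl⟩
    · intro ha
      have haS : a ∈ S := hS ((@ball_mono_radius L M (restrictRel F M) _ _ hd _) ha)
      obtain ⟨z, hz, hza⟩ := (@mem_ball_succ L M (restrictRel F M) _ _ _).1 ha
      have hz' := hz
      change z ∈ ballOn F d _ at hz
      rw [← ih] at hz
      obtain ⟨z, hz, rfl⟩ := hz
      refine ⟨⟨a, haS⟩, (@mem_ball_succ L S (restrictRel F S) _ _ _).2 ⟨z, hz, ?_⟩, rfl⟩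
      rcases hza with h | ⟨hne, k, R, t, ⟨hR, ht⟩, ⟨i, hi⟩, ⟨j, hj⟩⟩
      · exact Or.inl (Subtype.ext h)
      -- The tuple witnessing adjacency must lie entirely in `S`: all its entries are at distance at
      -- most `d + 1 ≤ r` from `X`.
      · have htS : ∀ j, t j ∈ S := fun j => hS <|
          (@ball_mono_radius L M (restrictRel F M) _ _ hd _)
            (@mem_ball_succ_of_relMap L M (restrictRel F M) d k _ R t ⟨hR, ht⟩ i
              (by rw [hi]; exact hz') j)
        exact Or.inr ⟨fun h => hne (congrArg Subtype.val h), k, R, fun j => ⟨t j, htS j⟩,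
          ⟨hR, ht⟩, ⟨i, Subtype.ext hi⟩, ⟨j, Subtype.ext hj⟩⟩

/-- Locality, for formulas with an arbitrary type of variables. -/
def RadiusLocal [L.IsRelational] (r : ℕ) (φ : L.Formula α) : Prop :=
  ∀ (A : Type w) [Finite A] [L.Structure A] (a : α → A),
    φ.Realize a ↔
      φ.Realize (M := induced L (ball L r (Set.range a)))
        (fun i => ⟨a i, subset_ball L r _ (Set.mem_range_self i)⟩)

theorem RadiusLocal.relabel [L.IsRelational] {β : Type*} {r : ℕ} {φ : L.Formula α} (h : RadiusLocal.{u, v, w} r φ)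
    (e : α ≃ β) : RadiusLocal.{u, v, w} r (φ.relabel e) := by
  intro A _ _ a
  rw [Formula.realize_relabel, Formula.realize_relabel, h]
  unfold Formula.Realize
  rw [realize_substructure_iff, realize_substructure_iff]
  have : Set.range (a ∘ e) = Set.range a := by simp
  simp only [induced, this]
  refine iff_of_eq ?_
  congr 1
  exact Subsingleton.elim _ _

/-- The relativisation of a formula to balls with respect to finitely many relation symbols is
a local formula. -/
theorem exists_radiusLocal [L.IsRelational] {α : Type} [Finite α] {F : Set (Σ k, L.Relations k)} (hF : F.Finite)
    (r : ℕ) (ψ : L.Formula α) :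
    ∃ ψ' : L.Formula α, RadiusLocal.{u, v, w} r ψ' ∧ ∀ (M : Type w) [L.Structure M] (x : α → M),
      ψ'.Realize x ↔ RealizeOn (ballOn F r (Set.range x)) ψ x default := by
  obtain ⟨D, hD⟩ := exists_ball_formula.{u, v, w} (α := α) hF r
  have key : ∀ (M : Type w) [L.Structure M] (x : α → M),
      Formula.Realize (relativize D ψ) x ↔ RealizeOn (ballOn F r (Set.range x)) ψ x default := by
    intro M _ x
    rw [Formula.Realize, realize_relativize]
    simp only [hD]
    rfl
  refine ⟨relativize D ψ, ?_, key⟩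
  intro A _ _ a
  rw [key, key]
  have hr : ∀ x : α → induced L (ball L r (Set.range a)),
      ((↑) : _ → A) '' Set.range x = Set.range fun i => (x i : A) := fun x => by
    ext; simp
  rw [← realizeOn_image (induced L (ball L r (Set.range a))).subtype]
  -- All that is needed is that the `F`-ball is the same set whether computed in the whole structure
  -- or in the induced ball, which contains it.
  have := image_ballOn_substructure F (induced L (ball L r (Set.range a)))
    (Set.range fun i => ⟨a i, subset_ball L r _ (Set.mem_range_self i)⟩) le_rfl
    (by rw [hr]; exact ballOn_subset_ball F r _)
  rw [hr] at this
  rw [← this]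
  refine iff_of_eq ?_
  congr 1
  exact Subsingleton.elim _ _

end Relational

/-! ### Feferman-Vaught decomposition for disjoint unions. -/

section FefermanVaught

variable {L : FirstOrder.Language.{u, v}} [L.IsRelational] {J ι : Type}

/-- The disjoint union of a family of structures, with marks that are constant on each part. -/
@[reducible]
def sigmaStructure (B : J → Type w) [∀ j, L.Structure (B j)] (b : ι → J → Prop) :
    (L.sum (markLang ι)).Structure (Σ j, B j) :=
  letI : L.Structure (Σ j, B j) :=
    { funMap := fun f => isEmptyElim f
      RelMap := fun R t => ∃ j, ∃ t' : Fin _ → B j, (∀ i, t i = ⟨j, t' i⟩) ∧ Structure.RelMap R t' }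
  letI := markStructure (fun i => {x : Σ j, B j | b i x.1})
  inferInstance

/-- A formula whose satisfaction in a disjoint union is determined by the satisfaction of
finitely many formulas in each part, where the variables are distributed to the parts by `e`. -/
def Decomposable (b : ι → J → Prop) {α : Type} {n : ℕ}
    (φ : (L.sum (markLang ι)).BoundedFormula α n) (V : J → Type) (e : α ⊕ Fin n → Σ j, V j) : Prop :=
  ∃ (K : Type) (_ : Finite K) (ψ : ∀ j, K → L.Formula (V j)) (F : (J → Set K) → Prop),
    ∀ (B : J → Type w) [∀ j, L.Structure (B j)] (x : ∀ j, V j → B j),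
      (letI := sigmaStructure (L := L) B b
       φ.Realize (M := Σ j, B j) (fun a => Sigma.map id x (e (Sum.inl a)))
        (fun i => Sigma.map id x (e (Sum.inr i)))) ↔
      F fun j => {k | (ψ j k).Realize (x j)}

/-- The Feferman-Vaught theorem for disjoint unions of relational structures. -/
theorem decomposable [Finite J] (b : ι → J → Prop) {α : Type} {n : ℕ}
    (φ : (L.sum (markLang ι)).BoundedFormula α n) (V : J → Type) (e : α ⊕ Fin n → Σ j, V j) :
    Decomposable.{u, v, w} b φ V e := by
  classical
  induction φ generalizing V with
  | falsum => exact ⟨Empty, inferInstance, fun _ k => k.elim, fun _ => False, fun _ _ _ => Iff.rfl⟩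
  | equal t₁ t₂ =>
    obtain ⟨a₁, rfl⟩ := exists_eq_var t₁
    obtain ⟨a₂, rfl⟩ := exists_eq_var t₂
    -- Equal elements lie in the same part, so an equation is tested in the part containing both
    -- variables and is `⊥` in every other part.
    refine ⟨Unit, inferInstance, fun j _ => if h : ∃ c : V j × V j, e a₁ = ⟨j, c.1⟩ ∧ e a₂ = ⟨j, c.2⟩
      then Term.equal (Term.var h.choose.1) (Term.var h.choose.2) else ⊥,
      fun σ => ∃ j, () ∈ σ j, ?_⟩
    intro B _ x
    have hv : ∀ a, (Sum.elim (fun a => Sigma.map id x (e (Sum.inl a)))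
        fun i => Sigma.map id x (e (Sum.inr i))) a = Sigma.map id x (e a) := by
      rintro (a | a) <;> rfl
    have hmap : ∀ {a j c}, e a = ⟨j, c⟩ → Sigma.map id x (e a) = ⟨j, x j c⟩ := by
      intro a j c h; rw [h]; rfl
    simp only [BoundedFormula.Realize, Term.realize_var, hv, Set.mem_ofPred_eq]
    constructor
    · intro h
      obtain ⟨j, c₁, hc₁⟩ : ∃ j c₁, e a₁ = ⟨j, c₁⟩ := ⟨_, _, rfl⟩
      obtain ⟨j', c₂, hc₂⟩ : ∃ j c₂, e a₂ = ⟨j, c₂⟩ := ⟨_, _, rfl⟩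
      obtain rfl : j = j' := congrArg Sigma.fst ((hmap hc₁).symm.trans (h.trans (hmap hc₂)))
      have hex : ∃ c : V j × V j, e a₁ = ⟨j, c.1⟩ ∧ e a₂ = ⟨j, c.2⟩ := ⟨(c₁, c₂), hc₁, hc₂⟩
      refine ⟨j, ?_⟩
      rw [dif_pos hex, Formula.realize_equal]
      obtain ⟨h₁, h₂⟩ := hex.choose_spec
      exact sigma_mk_injective ((hmap h₁).symm.trans (h.trans (hmap h₂)))
    · rintro ⟨j, h⟩
      split_ifs at h with hex
      · obtain ⟨h₁, h₂⟩ := hex.choose_spec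
        rw [Formula.realize_equal] at h
        exact (hmap h₁).trans ((congrArg (Sigma.mk j) h).trans (hmap h₂).symm)
      · exact h.elim
  | @rel n k R ts =>
    choose a ha using fun i => exists_eq_var (ts i)
    obtain rfl : ts = fun i => Term.var (a i) := funext ha
    have hv : ∀ (B : J → Type w) (x : ∀ j, V j → B j) a,
        (Sum.elim (fun a => Sigma.map id x (e (Sum.inl a)))
        fun i => Sigma.map id x (e (Sum.inr i))) a = Sigma.map id x (e a) := by
      rintro B x (a | a) <;> rfl
    rcases R with R | R
    · refine ⟨Unit, inferInstance, fun j _ => if h : ∃ c : Fin k → V j, ∀ i, e (a i) = ⟨j, c i⟩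
        then Relations.formula R (fun i => Term.var (h.choose i)) else ⊥,
        fun σ => ∃ j, () ∈ σ j, ?_⟩
      intro B _ x
      have hmap : ∀ {a j c}, e a = ⟨j, c⟩ → Sigma.map id x (e a) = ⟨j, x j c⟩ := by
        intro a j c h; rw [h]; rfl
      simp only [BoundedFormula.Realize, Term.realize_var, hv, Set.mem_ofPred_eq]
      refine exists_congr fun j => ?_
      constructor
      · rintro ⟨t, ht, hR⟩
        have hex : ∃ c : Fin k → V j, ∀ i, e (a i) = ⟨j, c i⟩ := by
          have : ∀ i, ∃ c : V j, e (a i) = ⟨j, c⟩ := by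
            intro i
            obtain ⟨j', c, hc⟩ : ∃ j c, e (a i) = ⟨j, c⟩ := ⟨_, _, rfl⟩
            obtain rfl : j' = j := congrArg Sigma.fst ((hmap hc).symm.trans (ht i))
            exact ⟨c, hc⟩
          choose c hc using this
          exact ⟨c, hc⟩
        rw [dif_pos hex, Formula.realize_rel]
        convert hR using 2 with i
        exact sigma_mk_injective ((hmap (hex.choose_spec i)).symm.trans (ht i))
      · intro h
        split_ifs at h with hex
        · rw [Formula.realize_rel] at h
          exact ⟨_, fun i => hmap (hex.choose_spec i), h⟩
        · exact h.elim
    · rcases R with ⟨i⟩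
      -- A mark is constant on each part, so its truth is fixed by the part to which the variable is
      -- assigned and no test formula is needed.
      refine ⟨Empty, inferInstance, fun _ k => k.elim, fun _ => b i (e (a 0)).1, ?_⟩
      intro B _ x
      simp only [BoundedFormula.Realize, Term.realize_var, hv]
      exact Iff.rfl
  | imp φ₁ φ₂ ih₁ ih₂ =>
    obtain ⟨K₁, _, ψ₁, F₁, h₁⟩ := ih₁ V e
    obtain ⟨K₂, _, ψ₂, F₂, h₂⟩ := ih₂ V e
    refine ⟨K₁ ⊕ K₂, inferInstance, fun j => Sum.elim (ψ₁ j) (ψ₂ j),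
      fun σ => F₁ (fun j => Sum.inl ⁻¹' σ j) → F₂ (fun j => Sum.inr ⁻¹' σ j), ?_⟩
    intro B _ x
    exact imp_congr (h₁ B x) (h₂ B x)
  | @all n φ ih =>
    -- A quantified element falls in some part `j₀`. The type `PLift (j = j₀)` adds one variable to
    -- part `j₀` and none to the others, so the induction hypothesis applies once for each `j₀`.
    let incl (j₀ : J) : (Σ j, V j) → Σ j, V j ⊕ PLift (j = j₀) := Sigma.map id fun _ => Sum.inl
    let e' (j₀ : J) : α ⊕ Fin (n + 1) → Σ j, V j ⊕ PLift (j = j₀) :=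
      Sum.elim (fun a => incl j₀ (e (Sum.inl a)))
        (Fin.snoc (α := fun _ => Σ j, V j ⊕ PLift (j = j₀)) (fun i => incl j₀ (e (Sum.inr i)))
          ⟨j₀, Sum.inr ⟨rfl⟩⟩)
    choose K hK ψ F h using fun j₀ => ih _ (e' j₀)
    have hev : ∀ (B : J → Type w) (x : ∀ j, V j → B j) (j₀ : J) (y : ∀ j, PLift (j = j₀) → B j),
        (fun i => Sigma.map id (fun j => Sum.elim (x j) (y j)) (e' j₀ (Sum.inr i))) =
          Fin.snoc (α := fun _ => Σ j, B j) (fun i => Sigma.map id x (e (Sum.inr i)))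
            ⟨j₀, y j₀ ⟨rfl⟩⟩ := by
      intro B x j₀ y
      funext i
      refine Fin.lastCases ?_ (fun i => ?_) i
      · have : e' j₀ (Sum.inr (Fin.last n)) = ⟨j₀, Sum.inr ⟨rfl⟩⟩ := by
          simp only [e', Sum.elim_inr, Fin.snoc_last]
        simp only [this, Fin.snoc_last]
        rfl
      · have : e' j₀ (Sum.inr i.castSucc) = incl j₀ (e (Sum.inr i)) := by
          simp only [e', Sum.elim_inr, Fin.snoc_castSucc]
        simp only [this, Fin.snoc_castSucc]
        rfl
    -- A test formula now says that a truth pattern of the old tests is realised by some choice of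
    -- the new variable. The choices in different parts are independent, so the quantifier ranges
    -- over all families of separately realisable patterns.
    refine ⟨Σ j₀, Set (K j₀), inferInstance, fun j k => Formula.iExs (PLift (j = k.1))
      (Formula.iInf fun l : K k.1 => if l ∈ k.2 then ψ k.1 j l else (ψ k.1 j l).not),
      fun σ => ∀ j₀ (θ : J → Set (K j₀)), (∀ j, ⟨j₀, θ j⟩ ∈ σ j) → F j₀ θ, ?_⟩
    intro B _ x
    have hmem : ∀ j₀ j (θ : Set (K j₀)) (y : PLift (j = j₀) → B j),
        (∀ l, (if l ∈ θ then ψ j₀ j l else (ψ j₀ j l).not).Realize (Sum.elim (x j) y)) ↔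
          {l | (ψ j₀ j l).Realize (Sum.elim (x j) y)} = θ := by
      intro j₀ j θ y
      rw [Set.ext_iff]
      refine forall_congr' fun l => ?_
      split_ifs with hl <;> simp [hl]
    simp only [BoundedFormula.Realize, Set.mem_ofPred_eq, Formula.realize_iExs,
      Formula.realize_iInf, hmem]
    constructor
    · intro hφ j₀ θ hθ
      choose y hy using hθ
      have := (h j₀ B fun j => Sum.elim (x j) (y j)).1
      rw [hev] at this
      have := this (hφ _)
      simpa only [hy] using this
    · rintro hF ⟨j₀, y₀⟩
      have := (h j₀ B fun j => Sum.elim (x j) (fun hj => hj.down.symm ▸ y₀)).2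
      rw [hev] at this
      exact this (hF j₀ _ fun j => ⟨_, rfl⟩)

end FefermanVaught

/-! ### Structures with marks and splitting of local formulas. -/

section Marks

variable {L : FirstOrder.Language.{u, v}} {ι : Type}

/-- The expansion of a structure by marks. -/
@[reducible]
def markedStructure {A : Type*} [L.Structure A] (X : ι → Set A) :
    (L.sum (markLang ι)).Structure A :=
  letI := markStructure X
  inferInstance

/-- A unary relation never links two distinct elements, so marks leave distances and balls
unchanged. -/
theorem gaifman_markedStructure {A : Type*} [L.Structure A] (X : ι → Set A) :
    @gaifman (L.sum (markLang ι)) A (markedStructure X) = gaifman L A := by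
  ext a b
  constructor
  · rintro ⟨hne, k, R | R, t, ht, ⟨i, hi⟩, ⟨j, hj⟩⟩
    · exact ⟨hne, k, R, t, ht, ⟨i, hi⟩, ⟨j, hj⟩⟩
    · rcases R with ⟨m⟩
      exact absurd (by rw [← hi, ← hj, Subsingleton.elim i j]) hne
  · rintro ⟨hne, k, R, t, ht, h⟩
    exact ⟨hne, k, Sum.inl R, t, ht, h⟩

theorem ball_markedStructure {A : Type*} [L.Structure A] (X : ι → Set A) (d : ℕ) (Y : Set A) :
    @ball (L.sum (markLang ι)) A (markedStructure X) d Y = ball L d Y := by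
  simp only [ball, gaifman_markedStructure]

variable [L.IsRelational]

theorem realize_restrictRel_iff {α : Type*} (φ : (L.sum (markLang ι)).Formula α)
    {F : Set (Σ k, L.Relations k)}
    (hF : ∀ k (R : L.Relations k), (⟨k, Sum.inl R⟩ : Σ k, (L.sum (markLang ι)).Relations k) ∈ rels φ →
      ⟨k, R⟩ ∈ F) {A : Type*} [L.Structure A] (X : ι → Set A) (x : α → A) :
    @Formula.Realize _ A (markedStructure X) _ φ x ↔
      @Formula.Realize _ A (@markedStructure L ι A (restrictRel F A) X) _ φ x := by
  refine (@realize_iff_of_rels _ _ _ A A (markedStructure X)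
    (@markedStructure L ι A (restrictRel F A) X) (Equiv.refl A) 0 φ ?_ x default).symm.trans ?_
  · rintro k (R | R) hR t
    · exact ⟨fun h => h.2, fun h => ⟨hF k R hR, h⟩⟩
    · exact Iff.rfl
  · exact iff_of_eq (congrArg _ (Subsingleton.elim _ _))

/-- A local formula, evaluated at points deep inside the parts of a partition on which the marks
are constant, is a Boolean combination of local formulas about the separate parts. -/
theorem IsRLocal.decompose {J : Type} [Finite J] [Nonempty J] {p r : ℕ}
    {φ : (L.sum (markLang ι)).Formula (Fin p)} (hφ : IsRLocal.{max u 0, max v 0, w} r φ)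
    (b : ι → J → Prop) (f : Fin p → J) :
    ∃ (K : Type) (_ : Finite K) (ψ : ∀ j, K → L.Formula {i // f i = j}) (F : (J → Set K) → Prop),
      (∀ j k, RadiusLocal.{u, v, w} r (ψ j k)) ∧
      ∀ (A : Type w) [Finite A] [L.Structure A] (X : ι → Set A) (U : J → Set A) (x : Fin p → A),
        (Pairwise fun i j => Disjoint (U i) (U j)) →
        (∀ i, ball L (r + 1) {x i} ⊆ U (f i)) →
        (∀ m, (⟨1, Sum.inr (MarkRel.mark m)⟩ : Σ k, (L.sum (markLang ι)).Relations k) ∈ rels φ →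
          ∀ i, ∀ y ∈ ball L r {x i}, y ∈ X m ↔ b m (f i)) →
        (@Formula.Realize _ A (markedStructure X) _ φ x ↔
          F fun j => {k | (ψ j k).Realize fun i => x i}) := by
  classical
  set F₀ : Set (Σ k, L.Relations k) :=
    (fun s : Σ k, L.Relations k => (⟨s.1, Sum.inl s.2⟩ : Σ k, (L.sum (markLang ι)).Relations k)) ⁻¹'
      rels φ with hF₀
  have hfin : F₀.Finite := by
    refine (rels_finite φ).preimage (Function.Injective.injOn ?_)
    rintro ⟨k, R⟩ ⟨k', R'⟩ h
    obtain rfl : k = k' := congrArg Sigma.fst h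
    have := Sum.inl_injective (eq_of_heq (Sigma.mk.inj h).2)
    exact congrArg (Sigma.mk k) this
  obtain ⟨K, hK, ψ₀, F, hF⟩ := decomposable.{u, v, w} b φ (fun j => {i // f i = j})
    (Sum.elim (fun i => ⟨f i, i, rfl⟩) Fin.elim0)
  choose ψ hψ hψ' using fun j k => exists_radiusLocal.{u, v, w} hfin r (ψ₀ j k)
  refine ⟨K, hK, ψ, F, hψ, ?_⟩
  intro A _ _ X U x hU hball hX
  have hballF : ∀ i, ballOn F₀ r {x i} ⊆ ball L r {x i} := fun i => ballOn_subset_ball _ _ _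
  let B : J → L.Substructure A := fun j =>
    induced L (ballOn F₀ r (Set.range fun i : {i // f i = j} => x i))
  have hB : ∀ j (y : A), y ∈ B j ↔ ∃ i, f i = j ∧ y ∈ ballOn F₀ r {x i} := by
    intro j y
    change y ∈ @ball L A (restrictRel F₀ A) r _ ↔ _
    rw [@ball_range_eq L A (restrictRel F₀ A)]
    simp [ballOn]
  have hBU : ∀ j (y : A), y ∈ B j → y ∈ U j := by
    intro j y hy
    obtain ⟨i, rfl, hy'⟩ := (hB j y).1 hy
    exact hball i (ball_mono_radius (Nat.le_succ r) _ (hballF i hy'))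
  have hUeq : ∀ {j j'} {y : A}, y ∈ U j → y ∈ U j' → j = j' := by
    intro j j' y h h'
    by_contra hne
    exact Set.disjoint_left.1 (hU hne) h h'
  let x' : ∀ j, {i // f i = j} → B j := fun j i => ⟨x i, (hB j _).2 ⟨i, i.2,
    @subset_ball L A (restrictRel F₀ A) _ _ _ rfl⟩⟩
  have hFV := hF (fun j => B j) x'
  have hloc : ∀ j k, (ψ₀ j k).Realize (x' j) ↔ (ψ j k).Realize fun i => x i := by
    intro j k
    rw [hψ' j k A, Formula.Realize, realize_substructure_iff]
    refine iff_of_eq ?_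
    congr 1
    exact Subsingleton.elim _ _
  simp only [hloc] at hFV
  rw [← hFV, realize_restrictRel_iff φ (F := F₀) (fun k R h => h)]
  let s₀ : (L.sum (markLang ι)).Structure A := @markedStructure L ι A (restrictRel F₀ A) X
  -- Locality is applied to the structure with only the relations of `φ` kept: its balls are the
  -- definable ones, and their disjoint union over the parts is the induced substructure.
  refine (hφ A x).trans ?_
  set S := induced (L.sum (markLang ι)) (ball (L.sum (markLang ι)) r (Set.range x)) with hS
  have hSmem : ∀ y, y ∈ S ↔ ∃ i, y ∈ ballOn F₀ r {x i} := by
    intro y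
    change y ∈ ball (L.sum (markLang ι)) r (Set.range x) ↔ _
    rw [@ball_markedStructure L ι A (restrictRel F₀ A), @ball_range_eq L A (restrictRel F₀ A)]
    simp [ballOn]
  let e : (Σ j, B j) ≃ S := Equiv.ofBijective
    (fun y => ⟨y.2, (hSmem _).2 (((hB _ _).1 y.2.2).imp fun _ h => h.2)⟩) <| by
      constructor
      · rintro ⟨j, y, hy⟩ ⟨j', y', hy'⟩ h
        obtain rfl : y = y' := congrArg Subtype.val h
        obtain rfl : j = j' := hUeq (hBU _ _ hy) (hBU _ _ hy')
        rfl
      · rintro ⟨y, hy⟩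
        obtain ⟨i, hi⟩ := (hSmem y).1 hy
        exact ⟨⟨f i, y, (hB _ _).2 ⟨i, rfl, hi⟩⟩, rfl⟩
  let := sigmaStructure (L := L) (fun j => B j) b
  refine Iff.trans ?_ (realize_iff_of_rels e φ ?_ _ _)
  · refine iff_of_eq ?_
    rw [Formula.Realize]
    congr 1
    exact Subsingleton.elim _ _
  · rintro k (R | R) hR t
    · constructor
      · rintro ⟨-, h⟩
        change Structure.RelMap R (fun i => ((t i).2 : A)) at h
        -- A related tuple stays in one part: it lies within `r + 1` of a variable, which is why the
        -- hypothesis on balls has radius `r + 1`. A nullary relation has no entry to choose the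
        -- part, hence the arbitrary element of `J`.
        have hex : ∃ j, ∀ i, (t i).1 = j := by
          rcases Nat.eq_zero_or_pos k with rfl | hk
          · exact ⟨Classical.arbitrary J, fun i => i.elim0⟩
          · refine ⟨(t ⟨0, hk⟩).1, fun i => ?_⟩
            obtain ⟨l, hl, hl'⟩ := (hB _ _).1 (t ⟨0, hk⟩).2.2
            refine hUeq (hBU _ _ (t i).2.2) ?_
            rw [← hl]
            exact hball l (mem_ball_succ_of_relMap h (i := ⟨0, hk⟩) (hballF l hl') i)
        obtain ⟨j, hj⟩ := hex
        have : ∀ i, ∃ y : B j, t i = ⟨j, y⟩ := by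
          intro i
          rw [← hj i]
          exact ⟨_, rfl⟩
        choose t' ht' using this
        obtain rfl : t = fun i => ⟨j, t' i⟩ := funext ht'
        exact ⟨j, t', fun _ => rfl, h⟩
      · rintro ⟨j, t', ht', h⟩
        obtain rfl : t = fun i => ⟨j, t' i⟩ := funext ht'
        exact ⟨hR, h⟩
    · rcases R with ⟨m⟩
      obtain ⟨i, hi, hi'⟩ := (hB _ _).1 (t 0).2.2
      change ((t 0).2 : A) ∈ X m ↔ b m (t 0).1
      rw [hX m hR i _ (hballF i hi'), hi]

end Marks

/-! ### Truth patterns and expansion of local formulas by marks. -/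

section LocalFormulas

variable {L : FirstOrder.Language.{u, v}} {α : Type*} {r : ℕ}

/-- The formula expressing that `s` is the set of those `k` for which `ψ k` holds. -/
noncomputable def exactly {K : Type} [Finite K] (ψ : K → L.Formula α) (s : Set K) : L.Formula α :=
  open Classical in Formula.iInf fun k => if k ∈ s then ψ k else (ψ k).not

/-- Distinct patterns `s` define disjoint sets of tuples, which turns a Boolean combination into a
disjoint union. -/
theorem realize_exactly {K : Type} [Finite K] (ψ : K → L.Formula α) (s : Set K) {M : Type*}
    [L.Structure M] (x : α → M) : (exactly ψ s).Realize x ↔ {k | (ψ k).Realize x} = s := by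
  classical
  rw [exactly, Formula.realize_iInf, Set.ext_iff]
  refine forall_congr' fun l => ?_
  split_ifs with hl <;> simp [hl]

theorem gaifman_reduct {ι : Type} {A : Type*} [(L.sum (markLang ι)).Structure A] :
    @gaifman L A ((LHom.sumInl : L →ᴸ L.sum (markLang ι)).reduct A) = gaifman (L.sum (markLang ι)) A := by
  ext a b
  constructor
  · rintro ⟨hne, k, R, t, ht, h⟩
    exact ⟨hne, k, Sum.inl R, t, ht, h⟩
  · rintro ⟨hne, k, R | R, t, ht, ⟨i, hi⟩, ⟨j, hj⟩⟩
    · exact ⟨hne, k, R, t, ht, ⟨i, hi⟩, ⟨j, hj⟩⟩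
    · rcases R with ⟨m⟩
      exact absurd (by rw [← hi, ← hj, Subsingleton.elim i j]) hne

theorem realizeOn_sumInl {ι : Type} {M : Type*} [(L.sum (markLang ι)).Structure M] (U : Set M)
    {n : ℕ} (φ : L.BoundedFormula α n) (v : α → M) (xs : Fin n → M) :
    RealizeOn U ((LHom.sumInl : L →ᴸ L.sum (markLang ι)).onBoundedFormula φ) v xs ↔
      @RealizeOn L _ M ((LHom.sumInl : L →ᴸ L.sum (markLang ι)).reduct M) U _ φ v xs := by
  let := (LHom.sumInl : L →ᴸ L.sum (markLang ι)).reduct M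
  induction φ with
  | falsum => rfl
  | equal t₁ t₂ => simp only [LHom.onBoundedFormula, RealizeOn, LHom.realize_onTerm, Term.bdEqual]
  | rel R ts =>
    simp only [LHom.onBoundedFormula, RealizeOn, Relations.boundedFormula, LHom.realize_onTerm,
      Function.comp_apply]
    rfl
  | imp φ ψ h₁ h₂ => simp only [LHom.onBoundedFormula, RealizeOn, h₁, h₂]
  | all φ ih => simp only [LHom.onBoundedFormula, RealizeOn, ih]

variable [L.IsRelational]

theorem RadiusLocal.exactly {K : Type} [Finite K] {ψ : K → L.Formula α}
    (h : ∀ k, RadiusLocal.{u, v, w} r (ψ k)) (s : Set K) :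
    RadiusLocal.{u, v, w} r (exactly ψ s) := by
  intro A _ _ a
  simp only [realize_exactly, ← h _ A a]

theorem RadiusLocal.sumInl {ι : Type} {φ : L.Formula α} (h : RadiusLocal.{u, v, w} r φ) :
    RadiusLocal.{max u 0, max v 0, w} r
      ((LHom.sumInl : L →ᴸ L.sum (markLang ι)).onFormula φ) := by
  intro A _ _ a
  let s := (LHom.sumInl : L →ᴸ L.sum (markLang ι)).reduct A
  rw [LHom.realize_onFormula, h, Formula.Realize, realize_substructure_iff, Formula.Realize,
    realize_substructure_iff]
  have : (induced L (ball L r (Set.range a)) : Set A) =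
      (induced (L.sum (markLang ι)) (ball (L.sum (markLang ι)) r (Set.range a)) : Set A) := by
    change ball L r _ = ball (L.sum (markLang ι)) r _
    simp only [ball, s, gaifman_reduct]
  rw [this]
  refine Iff.trans (iff_of_eq ?_) (realizeOn_sumInl _ φ _ _).symm
  congr 1
  exact Subsingleton.elim _ _

end LocalFormulas

/-! ### Product measures on finite probability spaces. -/

section Measure

variable {A : Type*} [MeasurableSpace A] [DiscreteMeasurableSpace A]
  (ν : Measure A) [IsProbabilityMeasure ν]


theorem pi_real_preimage_le {V : Type*} [Fintype V] (Z : Set A) :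
    (Measure.pi fun _ : V => ν).real {x | ∃ i, x i ∈ Z} ≤ Fintype.card V * ν.real Z := by
  have : {x : V → A | ∃ i, x i ∈ Z} = ⋃ i, (Function.eval i) ⁻¹' Z := by
    ext; simp
  rw [this]
  refine (measureReal_iUnion_fintype_le _).trans ?_
  have h : ∀ i : V, (Measure.pi fun _ : V => ν).real (Function.eval i ⁻¹' Z) = ν.real Z := fun i =>
    (measurePreserving_eval (fun _ : V => ν) i).measureReal_preimage
      (MeasurableSet.of_discrete.nullMeasurableSet)
  simp [h]

variable [Finite A]

/-- The symmetric difference consists of tuples meeting `Z`, whose measure is controlled by a union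
bound over the coordinates. -/
theorem abs_pi_real_sub_le {V : Type*} [Fintype V] (S T : Set (V → A)) (Z : Set A)
    (h : ∀ x : V → A, (∀ i, x i ∉ Z) → (x ∈ S ↔ x ∈ T)) :
    |(Measure.pi fun _ : V => ν).real S - (Measure.pi fun _ : V => ν).real T| ≤
      Fintype.card V * ν.real Z := by
  refine (abs_measureReal_sub_le_measureReal_symmDiff (Set.toFinite S).measurableSet.nullMeasurableSet
    (Set.toFinite T).measurableSet.nullMeasurableSet).trans (le_trans ?_ (pi_real_preimage_le ν Z))
  refine measureReal_mono fun x hx => ?_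
  by_contra hne
  have := h x (by simpa using hne)
  rcases hx with ⟨h₁, h₂⟩ | ⟨h₁, h₂⟩ <;> tauto

/-- The product measure of a set determined by independent conditions on the fibres of `f`. -/
theorem pi_real_fiberwise {V J : Type*} [Fintype V] [Fintype J] [DecidableEq J] (f : V → J)
    (T : ∀ j, Set ({i // f i = j} → A)) :
    (Measure.pi fun _ : V => ν).real {x | ∀ j, (fun i : {i // f i = j} => x i) ∈ T j} =
      ∏ j, (Measure.pi fun _ : {i // f i = j} => ν).real (T j) := by
  let g : (V → A) → ∀ j, {i // f i = j} → A := fun x j i => x i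
  have hg : Measurable g := by fun_prop
  have hmap : (Measure.pi fun _ : V => ν).map g =
      Measure.pi fun j => Measure.pi fun _ : {i // f i = j} => ν := by
    refine Measure.ext_of_singleton fun y => ?_
    rw [Measure.map_apply hg (measurableSet_singleton _), Measure.pi_singleton]
    have : g ⁻¹' {y} = {fun i => y (f i) ⟨i, rfl⟩} := by
      ext x
      simp only [Set.mem_preimage, Set.mem_singleton_iff, g]
      constructor
      · rintro rfl
        rfl
      · rintro rfl
        funext j i
        obtain ⟨i, rfl⟩ := i
        rfl
    rw [this, Measure.pi_singleton]
    simp only [Measure.pi_singleton]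
    rw [← Equiv.prod_comp (Equiv.sigmaFiberEquiv f), Fintype.prod_sigma]
    refine Finset.prod_congr rfl fun j _ => Finset.prod_congr rfl fun i _ => ?_
    obtain ⟨i, rfl⟩ := i
    rfl
  have hset : {x : V → A | ∀ j, (fun i : {i // f i = j} => x i) ∈ T j} =
      g ⁻¹' (Set.univ.pi T) := by
    ext x; simp [g, Set.mem_pi]
  rw [hset, measureReal_def, ← Measure.map_apply hg (Set.toFinite _).measurableSet, hmap,
    Measure.pi_pi, ENNReal.toReal_prod]
  rfl

theorem pi_real_reindex {V W : Type*} [Fintype V] [Fintype W] (e : V ≃ W) (S : Set (V → A)) :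
    (Measure.pi fun _ : W => ν).real {x | x ∘ e ∈ S} = (Measure.pi fun _ : V => ν).real S := by
  have := (measurePreserving_piCongrLeft (fun _ : W => ν) e).symm
  rw [← this.measureReal_preimage (Set.toFinite S).measurableSet.nullMeasurableSet]
  rfl

end Measure

/-! ### Convergence of statistics on the parts of a finite partition. -/

section Convergence

variable {L : FirstOrder.Language.{u, v}}

/-- The measure of the set of tuples of elements of `U` that satisfy `φ`. -/
noncomputable def stoneOn {V : Type} [Fintype V] (φ : L.Formula V) (A : ProbStr.{u, v, w} L)
    (U : Set A.carrier) : ℝ :=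
  (Measure.pi fun _ : V => A.ν).real {a | φ.Realize a ∧ ∀ i, a i ∈ U}

/-- The marks occurring in a formula. -/
def usedMarks {ι α : Type} (φ : (L.sum (markLang ι)).Formula α) : Set ι :=
  {m | (⟨1, Sum.inr (MarkRel.mark m)⟩ : Σ k, (L.sum (markLang ι)).Relations k) ∈ rels φ}

theorem usedMarks_finite {ι α : Type} (φ : (L.sum (markLang ι)).Formula α) :
    (usedMarks φ).Finite := by
  refine (rels_finite φ).preimage (Function.Injective.injOn fun m m' h => ?_)
  cases h
  rfl

/-- The points whose neighbourhood is contained in the part of the point and on which the marks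
are constant. -/
def deepSet (L : FirstOrder.Language.{u, v}) {A : Type w} [L.Structure A] {ι J : Type} (r : ℕ)
    (U : J → Set A) (X : ι → Set A) (b : ι → J → Prop) (I : Set ι) : Set A :=
  {y | ∀ j, y ∈ U j → ball L (r + 1) {y} ⊆ U j ∧ ∀ m ∈ I, ∀ z ∈ ball L r {y}, z ∈ X m ↔ b m j}

/-- A point fails to be deep either because its ball leaves its part, hence meets the boundary of
that part, or because its ball contains a point where a used mark differs from the union of parts
prescribed by `b`. -/
theorem compl_deepSet_subset {A : Type w} [L.Structure A] {ι J : Type} (r : ℕ)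
    {U : J → Set A} (hU : Pairwise fun i j => Disjoint (U i) (U j)) (X : ι → Set A)
    (b : ι → J → Prop) (I : Set ι) :
    (deepSet L r U X b I)ᶜ ⊆ (⋃ j, ball L (r + 1) (boundary L (U j))) ∪
      ⋃ m ∈ I, ball L r (symmDiff (X m) (⋃ j ∈ {j | b m j}, U j)) := by
  intro y hy
  by_contra hne
  simp only [Set.mem_union, Set.mem_iUnion, not_or, not_exists] at hne
  obtain ⟨h₁, h₂⟩ := hne
  refine hy fun j hj => ?_
  have hball : ball L (r + 1) {y} ⊆ U j := by
    intro z hz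
    by_contra hzU
    exact h₁ j (mem_ball_boundary hj hzU hz)
  refine ⟨hball, fun m hm z hz => ?_⟩
  have hzU := hball (ball_mono_radius (Nat.le_succ r) _ hz)
  have hzd : z ∉ symmDiff (X m) (⋃ j ∈ {j | b m j}, U j) := fun h =>
    h₂ m hm (mem_ball_iff_exists.2 ⟨z, h, hz⟩)
  have hb : (z ∈ ⋃ j ∈ {j | b m j}, U j) ↔ b m j := by
    simp only [Set.mem_iUnion, Set.mem_ofPred_eq, exists_prop]
    constructor
    · rintro ⟨j', hj', hz'⟩
      by_cases hjj : j' = j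
      · exact hjj ▸ hj'
      · exact absurd hzU (Set.disjoint_left.1 (hU hjj) hz')
    · exact fun h => ⟨j, h, hzU⟩
  rw [Set.mem_symmDiff] at hzd
  tauto

theorem Negligible.tendsto_real {A : ℕ → ProbStr.{u, v, w} L} {X : SubsetSeq A}
    (h : Negligible A X) (d : ℕ) :
    Tendsto (fun n => (A n).ν.real (ball L d (X n))) atTop (𝓝 0) := by
  have := (ENNReal.tendsto_toReal ENNReal.zero_ne_top).comp (h d)
  simpa [Function.comp_def, measureReal_def] using this

variable [L.IsRelational]

/-- Convergence of `⟨φ, A_n⟩` restricted to tuples of elements of `U_n`, for all local formulas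
with `p` free variables. -/
def ConvergesOn (A : ℕ → ProbStr.{u, v, w} L) (U : SubsetSeq A) (p : ℕ) : Prop :=
  ∀ φ : L.Formula (Fin p), IsLocal.{u, v, w} φ →
    ∃ l : ℝ, Tendsto (fun n => stoneOn φ (A n) (U n)) atTop (𝓝 l)

theorem ConvergesOn.exists_tendsto {A : ℕ → ProbStr.{u, v, w} L} {U : SubsetSeq A} {V : Type}
    [Fintype V] (h : ConvergesOn A U (Fintype.card V)) {φ : L.Formula V} {r : ℕ}
    (hφ : RadiusLocal.{u, v, w} r φ) :
    ∃ l : ℝ, Tendsto (fun n => stoneOn φ (A n) (U n)) atTop (𝓝 l) := by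
  obtain ⟨l, hl⟩ := h (φ.relabel (Fintype.equivFin V)) ⟨r, hφ.relabel _⟩
  refine ⟨l, hl.congr fun n => ?_⟩
  rw [stoneOn, stoneOn, ← pi_real_reindex _ (Fintype.equivFin V)]
  simp only [Formula.realize_relabel, Set.mem_ofPred_eq]
  congr 1
  ext x
  simp only [Set.mem_ofPred_eq, Function.comp_apply]
  rw [(Fintype.equivFin V).forall_congr_right (q := fun i => x i ∈ U n)]

variable {ι J : Type} [Fintype J] (A : ℕ → ProbStr.{u, v, w} L)
  {U : J → SubsetSeq A}

/-- On the tuples distributed to the parts `U` according to `f`, a local formula agrees, up to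
tuples meeting the complement of `deepSet`, with a set of tuples of convergent measure. -/
theorem exists_approx [DecidableEq J] [Nonempty J]
    (hU : ∀ n, Pairwise fun i j => Disjoint (U i n) (U j n))
    (X : ι → SubsetSeq A) {p r : ℕ}
    {φ : (L.sum (markLang ι)).Formula (Fin p)} (hφ : IsRLocal.{max u 0, max v 0, w} r φ)
    (b : ι → J → Prop) (f : Fin p → J)
    (hconv : ∀ j, ConvergesOn A (U j) (Fintype.card {i // f i = j})) :
    ∃ T : ∀ n, Set (Fin p → (A n).carrier),
      (∃ l, Tendsto (fun n => (Measure.pi fun _ : Fin p => (A n).ν).real (T n)) atTop (𝓝 l)) ∧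
      (∀ n, ∀ x ∈ T n, ∀ i, x i ∈ U (f i) n) ∧
      ∀ n x, (∀ i, x i ∈ U (f i) n) →
        (∀ i, x i ∈ deepSet L r (fun j => U j n) (fun m => X m n) b (usedMarks φ)) →
        (@Formula.Realize _ (A n).carrier (markedStructure fun m => X m n) _ φ x ↔ x ∈ T n) := by
  classical
  obtain ⟨K, hK, ψ, F, hloc, hF⟩ := IsRLocal.decompose.{u, v, w} hφ b f
  have : Fintype (J → Set K) := Fintype.ofFinite _
  let T : ∀ n, Set (Fin p → (A n).carrier) := fun n =>
    {x | F (fun j => {k | (ψ j k).Realize fun i => x i}) ∧ ∀ i, x i ∈ U (f i) n}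
  refine ⟨T, ?_, fun n x hx => hx.2, ?_⟩
  -- Splitting by truth pattern gives a disjoint union of sets defined by independent conditions on
  -- the fibres of `f`, so the measure is a finite sum of products.
  · have hT : ∀ n, (Measure.pi fun _ : Fin p => (A n).ν).real (T n) =
        ∑ θ : J → Set K with F θ, ∏ j, stoneOn (exactly (ψ j) (θ j)) (A n) (U j n) := by
      intro n
      let S : (J → Set K) → Set (Fin p → (A n).carrier) := fun θ =>
        {x | ∀ j, (fun i : {i // f i = j} => x i) ∈
          {y : {i // f i = j} → (A n).carrier | (exactly (ψ j) (θ j)).Realize y ∧ ∀ i, y i ∈ U j n}}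
      have hS : T n = ⋃ θ ∈ Finset.univ.filter F, S θ := by
        ext x
        simp only [T, S, Set.mem_ofPred_eq, Set.mem_iUnion, Finset.mem_filter, Finset.mem_univ,
          true_and, realize_exactly, exists_prop]
        constructor
        · rintro ⟨h₁, h₂⟩
          exact ⟨_, h₁, fun j => ⟨rfl, fun i => by simpa only [i.2] using h₂ i⟩⟩
        · rintro ⟨θ, h₁, h₂⟩
          refine ⟨?_, fun i => (h₂ (f i)).2 ⟨i, rfl⟩⟩
          convert h₁ with j
          exact (h₂ j).1
      rw [hS, measureReal_biUnion_finset]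
      · exact Finset.sum_congr rfl fun θ _ => pi_real_fiberwise (A n).ν f _
      · intro θ _ θ' _ hne
        refine Set.disjoint_left.2 fun x hx hx' => hne (funext fun j => ?_)
        have h₁ := (realize_exactly _ _ _).1 (hx j).1
        have h₂ := (realize_exactly _ _ _).1 (hx' j).1
        exact h₁.symm.trans h₂
      · exact fun θ _ => (Set.toFinite _).measurableSet
    choose l hl using fun (θ : J → Set K) j =>
      (hconv j).exists_tendsto (RadiusLocal.exactly (hloc j) (θ j))
    refine ⟨∑ θ : J → Set K with F θ, ∏ j, l θ j, ?_⟩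
    simp only [hT]
    exact tendsto_finsetSum _ fun θ _ => tendsto_finsetProd _ fun j _ => hl θ j
  · intro n x hxU hdeep
    rw [hF (A n).carrier (fun m => X m n) (fun j => U j n) x (hU n)
      (fun i => (hdeep i _ (hxU i)).1) (fun m hm i y hy => (hdeep i _ (hxU i)).2 m hm y hy)]
    exact ⟨fun h => ⟨h, hxU⟩, fun h => h.1⟩

/-- Summing the approximations over all assignments `f` of variables to parts costs only one error
term, since the sets for different `f` are disjoint and deep tuples are judged correctly. -/
theorem exists_approx_stone [DecidableEq J] [Nonempty J]
    (hU : ∀ n, Pairwise fun i j => Disjoint (U i n) (U j n))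
    (hcover : ∀ n, ⋃ j, U j n = Set.univ)
    (hconv : ∀ j p, ConvergesOn A (U j) p) (X : ι → SubsetSeq A) {p r : ℕ}
    {φ : (L.sum (markLang ι)).Formula (Fin p)} (hφ : IsRLocal.{max u 0, max v 0, w} r φ)
    (b : ι → J → Prop) :
    ∃ c : ℕ → ℝ, (∃ l, Tendsto c atTop (𝓝 l)) ∧
      ∀ n, |stone φ ((A n).lift fun m => X m n) - c n| ≤
        p * (A n).ν.real (deepSet L r (fun j => U j n) (fun m => X m n) b (usedMarks φ))ᶜ := by
  choose T hT hTU hTφ using fun f : Fin p → J =>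
    exists_approx A hU X hφ b f (fun j => hconv j _)
  choose l hl using hT
  refine ⟨fun n => ∑ f, (Measure.pi fun _ : Fin p => (A n).ν).real (T f n),
    ⟨∑ f, l f, tendsto_finsetSum _ fun f _ => hl f⟩, fun n => ?_⟩
  beta_reduce
  rw [← measureReal_iUnion_fintype]
  · have := abs_pi_real_sub_le (A n).ν
      {x | @Formula.Realize _ (A n).carrier (markedStructure fun m => X m n) _ φ x} (⋃ f, T f n)
      (deepSet L r (fun j => U j n) (fun m => X m n) b (usedMarks φ))ᶜ ?_
    · rw [Fintype.card_fin] at this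
      exact this
    · intro x hx
      have hx' := fun i => not_not.1 (hx i)
      have : ∀ i, ∃ j, x i ∈ U j n := fun i => Set.mem_iUnion.1 (hcover n ▸ Set.mem_univ (x i))
      choose f hf using this
      rw [Set.mem_ofPred_eq, hTφ f n x hf hx', Set.mem_iUnion]
      refine ⟨fun h => ⟨f, h⟩, ?_⟩
      rintro ⟨f', h⟩
      have : f' = f := funext fun i => by
        by_contra hne
        exact Set.disjoint_left.1 (hU n hne) (hTU f' n x h i) (hf i)
      exact this ▸ h
  · intro f f' hne
    refine Set.disjoint_left.2 fun x hx hx' => hne (funext fun i => ?_)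
    by_contra hne
    exact Set.disjoint_left.1 (hU n hne) (hTU f n x hx i) (hTU f' n x hx' i)
  · exact fun f => (Set.toFinite _).measurableSet

/-- If `A` is local-convergent, and all parts but one of a partition with negligible boundaries
have convergent statistics, then so has the remaining part. -/
theorem convergesOn_of_forall_ne [DecidableEq J]
    (hU : ∀ n, Pairwise fun i j => Disjoint (U i n) (U j n))
    (hA : LocalConvergent A)
    (hcover : ∀ n, ⋃ j, U j n = Set.univ)
    (hneg : ∀ j, Negligible A fun n => boundary L (U j n)) (j₀ : J)
    (hconv : ∀ j, j ≠ j₀ → ∀ p, ConvergesOn A (U j) p) (p : ℕ) : ConvergesOn A (U j₀) p := by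
  have : Nonempty J := ⟨j₀⟩
  induction p using Nat.strong_induction_on with
  | _ p ih =>
    rintro φ ⟨r, hφ⟩
    -- An empty family of marks lets the approximation for marked structures be used for the
    -- unmarked formula.
    let X : Empty → SubsetSeq A := fun m => m.elim
    let P : (Fin p → J) → ∀ n, Set (Fin p → (A n).carrier) := fun f n =>
      {a | φ.Realize a ∧ ∀ i, a i ∈ U (f i) n}
    let Z : ℕ → ℝ := fun n => ∑ j, (A n).ν.real (ball L (r + 1) (boundary L (U j n)))
    have hZ : Tendsto (fun n => (p : ℝ) * Z n) atTop (𝓝 0) := by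
      have : Tendsto Z atTop (𝓝 (∑ _j : J, 0)) :=
        tendsto_finsetSum _ fun j _ => (hneg j).tendsto_real (r + 1)
      simpa using this.const_mul (p : ℝ)
    -- Unless `f` is constantly `j₀`, fewer than `p` variables fall in `j₀`, so the induction
    -- hypothesis covers that part.
    have hf : ∀ f : Fin p → J, f ≠ (fun _ => j₀) → ∃ l,
        Tendsto (fun n => (Measure.pi fun _ : Fin p => (A n).ν).real (P f n)) atTop (𝓝 l) := by
      intro f hne
      obtain ⟨T, ⟨l, hl⟩, hTU, hTφ⟩ := exists_approx A hU X
        (φ := (LHom.sumInl : L →ᴸ L.sum (markLang Empty)).onFormula φ) (r := r)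
        (RadiusLocal.sumInl hφ) (fun m => m.elim) f (fun j => by
          by_cases hj : j = j₀
          · subst hj
            refine ih _ ?_
            obtain ⟨i, hi⟩ := Function.ne_iff.1 hne
            have := Fintype.card_subtype_lt (p := fun i => f i = j) hi
            rwa [Fintype.card_fin] at this
          · exact hconv j hj _)
      refine ⟨l, ?_⟩
      have hclose : ∀ n, |(Measure.pi fun _ : Fin p => (A n).ν).real (P f n) -
          (Measure.pi fun _ : Fin p => (A n).ν).real (T n)| ≤ p * Z n := by
        intro n
        refine (abs_pi_real_sub_le (A n).ν (P f n) (T n)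
          (⋃ j, ball L (r + 1) (boundary L (U j n))) ?_).trans ?_
        · intro x hx
          have hx' : ∀ i, x i ∈ deepSet L r (fun j => U j n) (fun m => X m n)
              (fun m => m.elim) (usedMarks ((LHom.sumInl : L →ᴸ L.sum (markLang Empty)).onFormula φ)) := by
            intro i
            by_contra hi
            rcases compl_deepSet_subset r (hU n) _ _ _ hi with h | h
            · exact hx i h
            · simp at h
          constructor
          · rintro ⟨h₁, h₂⟩
            refine (hTφ n x h₂ hx').1 ?_
            let := markStructure fun m => X m n
            exact (LHom.realize_onFormula _ _).2 h₁
          · intro h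
            refine ⟨?_, hTU n x h⟩
            let := markStructure fun m => X m n
            exact (LHom.realize_onFormula (LHom.sumInl : L →ᴸ L.sum (markLang Empty)) φ).1
              ((hTφ n x (hTU n x h) hx').2 h)
        · rw [Fintype.card_fin]
          gcongr
          exact measureReal_iUnion_fintype_le _
      have h0 := squeeze_zero_norm (fun n => by
        rw [Real.norm_eq_abs]; exact hclose n) hZ
      simpa using h0.add hl
    choose! l hl using hf
    obtain ⟨l₀, hl₀⟩ := hA p φ ⟨r, hφ⟩
    -- The constant assignment is the only unknown term in the convergent total, so its limit is
    -- found by subtraction.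
    refine ⟨l₀ - ∑ f ∈ Finset.univ.erase (fun _ => j₀), l f, ?_⟩
    refine (hl₀.sub (tendsto_finsetSum (Finset.univ.erase (fun _ : Fin p => j₀))
      fun f hf => hl f (Finset.ne_of_mem_erase hf))).congr fun n => ?_
    have hsum : stone φ (A n) = ∑ f, (Measure.pi fun _ : Fin p => (A n).ν).real (P f n) := by
      rw [← measureReal_iUnion_fintype, stone]
      · congr 1
        ext x
        have : ∀ i, ∃ j, x i ∈ U j n := fun i => Set.mem_iUnion.1 (hcover n ▸ Set.mem_univ (x i))
        choose f hf using this
        simp only [Set.mem_ofPred_eq, Set.mem_iUnion, P]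
        exact ⟨fun h => ⟨f, h, hf⟩, fun ⟨_, h, _⟩ => h⟩
      · intro f f' hne
        refine Set.disjoint_left.2 fun x hx hx' => hne (funext fun i => ?_)
        by_contra hne
        exact Set.disjoint_left.1 (hU n hne) (hx.2 i) (hx'.2 i)
      · exact fun f => (Set.toFinite _).measurableSet
    rw [hsum, ← Finset.add_sum_erase _ _ (Finset.mem_univ fun _ => j₀), add_sub_cancel_right]
    rfl

end Convergence

/-! ### Boundaries, negligibility and statistics of clusters. -/

section Clusters

variable {L : FirstOrder.Language.{u, v}}

theorem ball_empty {A : Type w} [L.Structure A] (d : ℕ) : ball L d (∅ : Set A) = ∅ := by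
  simp [ball]

theorem boundary_empty {A : Type w} [L.Structure A] : boundary L (∅ : Set A) = ∅ := by
  simp [boundary, ball_empty]

theorem boundary_iUnion_subset {A : Type w} [L.Structure A] {κ : Sort*} (X : κ → Set A) :
    boundary L (⋃ i, X i) ⊆ ⋃ i, boundary L (X i) := by
  rintro x ⟨hx, hx'⟩
  rw [ball_iUnion] at hx
  obtain ⟨i, hi⟩ := Set.mem_iUnion.1 hx
  exact Set.mem_iUnion.2 ⟨i, hi, fun h => hx' (Set.mem_iUnion.2 ⟨i, h⟩)⟩

theorem boundary_compl_subset {A : Type w} [L.Structure A] (X : Set A) :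
    boundary L Xᶜ ⊆ ball L 1 (boundary L X) := by
  rintro x ⟨hx, hx'⟩
  obtain ⟨z, hz, hzx⟩ := hx
  rw [Set.notMem_compl_iff] at hx'
  have hxz : x ∈ ball L 1 {z} := mem_ball_singleton.2 hzx
  exact mem_ball_iff_exists.2 ⟨z, ⟨⟨x, hx', mem_ball_singleton.1 (mem_ball_singleton_comm.1 hxz)⟩, hz⟩,
    mem_ball_singleton_comm.1 hxz⟩

/-- A ball around a set is covered by the set and a ball around its boundary. -/
theorem ball_subset_union_ball_boundary {A : Type w} [L.Structure A] (d : ℕ) (X : Set A) :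
    ball L d X ⊆ X ∪ ball L (d + d) (boundary L X) := by
  intro y hy
  by_cases hyX : y ∈ X
  · exact Or.inl hyX
  · obtain ⟨x, hx, hxy⟩ := hy
    have h := mem_ball_boundary hx hyX (mem_ball_singleton.2 hxy)
    exact Or.inr (ball_ball_subset d d _ ⟨x, h, hxy⟩)

theorem negligible_of_tendsto_real {A : ℕ → ProbStr.{u, v, w} L} {X : SubsetSeq A}
    (h : ∀ d, Tendsto (fun n => (A n).ν.real (ball L d (X n))) atTop (𝓝 0)) : Negligible A X := by
  intro d
  have := ENNReal.tendsto_ofReal (h d)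
  simpa using this

theorem Negligible.boundary_compl {A : ℕ → ProbStr.{u, v, w} L} {X : SubsetSeq A}
    (h : Negligible A fun n => boundary L (X n)) :
    Negligible A fun n => boundary L (X n)ᶜ := by
  intro d
  refine tendsto_of_tendsto_of_tendsto_of_le_of_le tendsto_const_nhds (h (d + 1))
    (fun _ => by simp) fun n => measure_mono ?_
  exact (ball_mono (boundary_compl_subset _)).trans (ball_ball_subset _ _ _)

theorem Negligible.boundary_iUnion {A : ℕ → ProbStr.{u, v, w} L} {κ : Type*} [Fintype κ]
    {X : κ → SubsetSeq A} (h : ∀ j, Negligible A fun n => boundary L (X j n)) :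
    Negligible A fun n => boundary L (⋃ j, X j n) := by
  refine negligible_of_tendsto_real fun d => ?_
  have h0 : Tendsto (fun n => ∑ j, (A n).ν.real (ball L d (boundary L (X j n)))) atTop (𝓝 0) := by
    simpa using tendsto_finsetSum Finset.univ fun j _ => (h j).tendsto_real d
  refine squeeze_zero (fun _ => measureReal_nonneg) (fun n => ?_) h0
  refine (measureReal_mono (ball_mono (boundary_iUnion_subset _))).trans ?_
  rw [ball_iUnion]
  exact measureReal_iUnion_fintype_le _

variable [L.IsRelational]

/-- Requiring every variable to carry the cluster's mark is itself a local condition, so the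
restricted statistic is a Stone pairing of the marked sequence. -/
theorem IsCluster.convergesOn {A : ℕ → ProbStr.{u, v, w} L} {X : SubsetSeq A} (h : IsCluster A X)
    (p : ℕ) : ConvergesOn A X p := by
  rintro φ ⟨r, hφ⟩
  let φ' : (L.sum (markLang Unit)).Formula (Fin p) :=
    (LHom.sumInl : L →ᴸ L.sum (markLang Unit)).onFormula φ ⊓ Formula.iInf fun i : Fin p =>
      Relations.formula (L := L.sum (markLang Unit)) (Sum.inr (MarkRel.mark ())) fun _ : Fin 1 => Term.var i
  have hφ' : IsRLocal.{max u 0, max v 0, w} r φ' := by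
    intro B _ _ a
    simp only [φ', Formula.realize_inf, Formula.realize_iInf]
    exact and_congr (RadiusLocal.sumInl hφ B a) Iff.rfl
  obtain ⟨l, hl⟩ := h.1 p φ' ⟨r, hφ'⟩
  refine ⟨l, hl.congr fun n => ?_⟩
  rw [stone, stoneOn]
  congr 1
  ext a
  simp only [φ', Set.mem_ofPred_eq, Formula.realize_inf, Formula.realize_iInf]
  let := markStructure fun _ : Unit => X n
  exact and_congr (LHom.realize_onFormula _ _) Iff.rfl

theorem ConvergesOn.exists_tendsto_measure {A : ℕ → ProbStr.{u, v, w} L} {X : SubsetSeq A}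
    (h : ConvergesOn A X 1) : ∃ l : ℝ, Tendsto (fun n => (A n).ν.real (X n)) atTop (𝓝 l) := by
  obtain ⟨l, hl⟩ := h ⊤ ⟨0, fun B _ _ a => by simp⟩
  refine ⟨l, hl.congr fun n => ?_⟩
  have : {a : Fin 1 → (A n).carrier | (⊤ : L.Formula (Fin 1)).Realize a ∧ ∀ i, a i ∈ X n} =
      Set.univ.pi fun _ => X n := by
    ext a
    simp
  rw [stoneOn, this, measureReal_def, Measure.pi_pi]
  simp [measureReal_def]

end Clusters

/-- The Cauchy property passes through approximations by convergent sequences, which may change with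
`ε`. -/
theorem exists_tendsto_of_forall_approx {a : ℕ → ℝ}
    (h : ∀ ε > 0, ∃ c : ℕ → ℝ, (∃ l, Tendsto c atTop (𝓝 l)) ∧ ∀ᶠ n in atTop, |a n - c n| ≤ ε) :
    ∃ l, Tendsto a atTop (𝓝 l) := by
  refine cauchySeq_tendsto_of_complete (Metric.cauchySeq_iff.2 fun ε hε => ?_)
  obtain ⟨c, ⟨l, hl⟩, hc⟩ := h (ε / 4) (by positivity)
  obtain ⟨N₁, h₁⟩ := Metric.cauchySeq_iff.1 hl.cauchySeq (ε / 4) (by positivity)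
  obtain ⟨N₂, h₂⟩ := eventually_atTop.1 hc
  refine ⟨max N₁ N₂, fun m hm n hn => ?_⟩
  have e₁ := h₁ m (le_of_max_le_left hm) n (le_of_max_le_left hn)
  have e₂ := h₂ m (le_of_max_le_right hm)
  have e₃ := h₂ n (le_of_max_le_right hn)
  rw [Real.dist_eq, abs_lt] at *
  rw [abs_le] at e₂ e₃
  constructor <;> linarith

/-! ### Countable unions in real-valued form. -/

section Measure

variable {α : Type*} [MeasurableSpace α] {ν : Measure α} [IsFiniteMeasure ν]

theorem measureReal_iUnion_le_tsum {f : ℕ → Set α} (h : Summable fun j => ν.real (f j)) :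
    ν.real (⋃ j, f j) ≤ ∑' j, ν.real (f j) := by
  refine ENNReal.toReal_le_of_le_ofReal (tsum_nonneg fun _ => measureReal_nonneg) ?_
  rw [ENNReal.ofReal_tsum_of_nonneg (fun _ => measureReal_nonneg) h]
  simpa using measure_iUnion_le (μ := ν) f

theorem hasSum_measureReal_iUnion {f : ℕ → Set α} (hf : Pairwise fun i j => Disjoint (f i) (f j))
    (hm : ∀ j, MeasurableSet (f j)) :
    HasSum (fun j => ν.real (f j)) (ν.real (⋃ j, f j)) := by
  have h := measure_iUnion (μ := ν) hf hm
  have hne : ∑' j, ν (f j) ≠ ⊤ := h ▸ measure_ne_top ν _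
  have := ENNReal.hasSum_toReal hne
  rwa [← ENNReal.tsum_toReal_eq (fun j => measure_ne_top ν _), ← h] at this

end Measure

/-! ### The comb of marks, under summable bounds. -/

section Comb

variable {L : FirstOrder.Language.{u, v}} {A : ℕ → ProbStr.{u, v, w} L}

/-- The family of marks consisting of the sets `W j`, preceded by the complement of their closed
neighbourhood. -/
def combMarks (W : ℕ → SubsetSeq A) : ℕ → SubsetSeq A
  | 0 => fun n => (ball L 1 (⋃ j, W j n))ᶜ
  | j + 1 => W j

theorem StronglyDisjoint.notMem_ball {X Y : SubsetSeq A} (h : StronglyDisjoint A X Y) {n : ℕ}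
    {x : (A n).carrier} (hx : x ∈ Y n) : x ∉ ball L 1 (X n) := fun hx' => by
  have : x ∈ (ball L 1 (X n) ∩ Y n) ∪ (X n ∩ ball L 1 (Y n)) := Or.inl ⟨hx', hx⟩
  rw [h n] at this
  exact this

variable {W : ℕ → SubsetSeq A}

/-- A point missed by `M_0` is within distance one of some `W j`, so if unmarked it lies in the
boundary of `W j`. Conversely, strong disjointness keeps a boundary point of one cluster out of all
the others. -/
theorem unmarked_combMarks (hW : ∀ i j, i ≠ j → StronglyDisjoint A (W i) (W j)) (n : ℕ) :
    unmarked A (combMarks W) n = ⋃ j, boundary L (W j n) := by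
  ext x
  simp only [unmarked, Set.mem_compl_iff, Set.mem_iUnion, not_exists]
  constructor
  · intro h
    have h0 := h 0
    simp only [combMarks, Set.notMem_compl_iff, ball_iUnion, Set.mem_iUnion] at h0
    obtain ⟨j, hj⟩ := h0
    exact ⟨j, hj, h (j + 1)⟩
  · rintro ⟨j, hj, hj'⟩ (_ | k)
    · simp only [combMarks, Set.notMem_compl_iff, ball_iUnion, Set.mem_iUnion]
      exact ⟨j, hj⟩
    · intro hk
      by_cases hjk : j = k
      · exact hj' (hjk ▸ hk)
      · exact (hW j k hjk).notMem_ball hk hj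

theorem pairwise_disjoint_of_stronglyDisjoint (hW : ∀ i j, i ≠ j → StronglyDisjoint A (W i) (W j))
    (n : ℕ) : Pairwise fun i j => Disjoint (W i n) (W j n) := fun i j hij =>
  Set.disjoint_left.2 fun _ hx hx' => (hW i j hij).notMem_ball hx' (subset_ball L 1 _ hx)

theorem combMarks_disjoint (hW : ∀ i j, i ≠ j → StronglyDisjoint A (W i) (W j)) (n : ℕ) :
    Pairwise fun i j => Disjoint (combMarks W i n) (combMarks W j n) := by
  have h0 : ∀ j, Disjoint (combMarks W 0 n) (combMarks W (j + 1) n) := fun j =>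
    Set.disjoint_left.2 fun x hx hx' =>
      hx (subset_ball L 1 _ (Set.mem_iUnion.2 ⟨j, hx'⟩))
  rintro (_ | i) (_ | j) hij
  · exact absurd rfl hij
  · exact h0 j
  · exact (h0 i).symm
  · exact pairwise_disjoint_of_stronglyDisjoint hW n (by simpa using hij)

theorem boundary_combMarks_subset (hW : ∀ i j, i ≠ j → StronglyDisjoint A (W i) (W j)) (n : ℕ) :
    (⋃ i, boundary L (combMarks W i n)) ⊆ unmarked A (combMarks W) n := by
  refine Set.iUnion_subset fun i => ?_
  rcases i with _ | i
  · rintro x ⟨⟨z, hz, hzx⟩, hx'⟩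
    rw [unmarked_combMarks hW]
    simp only [combMarks, Set.notMem_compl_iff, ball_iUnion, Set.mem_iUnion] at hx'
    obtain ⟨j, hj⟩ := hx'
    refine Set.mem_iUnion.2 ⟨j, hj, fun hxj => hz ?_⟩
    refine ⟨x, Set.mem_iUnion.2 ⟨j, hxj⟩, ?_⟩
    rwa [SimpleGraph.edist_comm]
  · rw [unmarked_combMarks hW]
    exact Set.subset_iUnion (fun j => boundary L (W j n)) i

theorem negligible_unmarked_combMarks (hW : ∀ i j, i ≠ j → StronglyDisjoint A (W i) (W j))
    (hneg : ∀ j, Negligible A fun n => boundary L (W j n)) {g : ℕ → ℝ} (hg : Summable g)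
    (hbound : ∀ j d n, d ≤ j → (A n).ν.real (ball L d (boundary L (W j n))) ≤ g j) :
    Negligible A (unmarked A (combMarks W)) := by
  refine negligible_of_tendsto_real fun d => ?_
  -- The bound `g j` only covers radii `d ≤ j`; the finitely many earlier terms are bounded by `1`,
  -- which keeps the majorant summable.
  let g' : ℕ → ℝ := fun j => if j < d then 1 else g j
  have hg' : Summable g' := by
    refine hg.congr_cofinite ?_
    rw [Nat.cofinite_eq_atTop]
    filter_upwards [eventually_ge_atTop d] with j hj
    simp [g', hj.not_gt]
  have hle : ∀ n j, (A n).ν.real (ball L d (boundary L (W j n))) ≤ g' j := by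
    intro n j
    simp only [g']
    split_ifs with h
    · exact measureReal_le_one
    · exact hbound j d n (not_lt.1 h)
  have h0 : Tendsto (fun n => ∑' j, (A n).ν.real (ball L d (boundary L (W j n)))) atTop (𝓝 0) := by
    have := tendsto_tsum_of_dominated_convergence (𝓕 := atTop) hg'
      (fun j => (hneg j).tendsto_real d) (Eventually.of_forall fun n j => by
        rw [Real.norm_of_nonneg measureReal_nonneg]; exact hle n j)
    simpa using this
  refine squeeze_zero (fun _ => measureReal_nonneg) (fun n => ?_) h0
  rw [unmarked_combMarks hW, ball_iUnion]
  exact measureReal_iUnion_le_tsum (hg'.of_nonneg_of_le (fun _ => measureReal_nonneg) (hle n))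

theorem stable_combMarks (hW : ∀ i j, i ≠ j → StronglyDisjoint A (W i) (W j))
    (hS : Negligible A (unmarked A (combMarks W))) {f : ℕ → ℝ} (hf : Summable f)
    (hbound : ∀ j n, (A n).ν.real (W j n) ≤ f j)
    (hlim : ∀ j, ∃ l, Tendsto (fun n => (A n).ν.real (W j n)) atTop (𝓝 l)) :
    ∃ l : ℕ → ENNReal,
      (∀ i, Tendsto (fun n => (A n).ν (combMarks W i n)) atTop (𝓝 (l i))) ∧ ∑' i, l i = 1 ∧
        Tendsto (fun n => ∑' i, (A n).ν (combMarks W i n)) atTop (𝓝 1) := by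
  choose l hl using hlim
  have hS0 : Tendsto (fun n => (A n).ν.real (unmarked A (combMarks W) n)) atTop (𝓝 0) := by
    simpa only [ball_zero] using hS.tendsto_real 0
  have hunion : ∀ n, (A n).ν.real (⋃ i, combMarks W i n) =
      1 - (A n).ν.real (unmarked A (combMarks W) n) := by
    intro n
    rw [← probReal_compl_eq_one_sub MeasurableSet.of_discrete, unmarked, compl_compl]
  have hsum : ∀ n, HasSum (fun i => (A n).ν.real (combMarks W i n))
      (1 - (A n).ν.real (unmarked A (combMarks W) n)) := fun n =>
    hunion n ▸ hasSum_measureReal_iUnion (combMarks_disjoint hW n) fun _ => MeasurableSet.of_discrete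
  have hl0 : ∀ j, 0 ≤ l j := fun j => ge_of_tendsto' (hl j) fun _ => measureReal_nonneg
  have hlf : ∀ j, l j ≤ f j := fun j => le_of_tendsto' (hl j) (hbound j)
  have hlsum : Summable l := hf.of_nonneg_of_le hl0 hlf
  have htsum : Tendsto (fun n => ∑' j, (A n).ν.real (W j n)) atTop (𝓝 (∑' j, l j)) :=
    tendsto_tsum_of_dominated_convergence hf hl (Eventually.of_forall fun n j => by
      rw [Real.norm_of_nonneg measureReal_nonneg]; exact hbound j n)
  -- The mass of `M_0` is what the unmarked set and the clusters leave, and the total cluster mass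
  -- converges by domination by `f`.
  have hM0 : Tendsto (fun n => (A n).ν.real (combMarks W 0 n)) atTop (𝓝 (1 - ∑' j, l j)) := by
    have := ((tendsto_const_nhds (x := (1 : ℝ))).sub hS0).sub htsum
    rw [sub_zero] at this
    refine this.congr fun n => ?_
    have h := (hsum n).summable.tsum_eq_zero_add
    rw [(hsum n).tsum_eq] at h
    rw [h, sub_eq_iff_eq_add]
    rfl
  let l' : ℕ → ℝ := fun i => Nat.casesOn i (1 - ∑' j, l j) l
  have hl' : ∀ i, Tendsto (fun n => (A n).ν.real (combMarks W i n)) atTop (𝓝 (l' i)) := by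
    rintro (_ | i)
    · exact hM0
    · exact hl i
  have hl'sum : Summable l' := (summable_nat_add_iff 1).1 hlsum
  have hl'one : ∑' i, l' i = 1 := by
    rw [hl'sum.tsum_eq_zero_add]
    exact sub_add_cancel _ _
  refine ⟨fun i => ENNReal.ofReal (l' i), fun i => ?_, ?_, ?_⟩
  · simpa using ENNReal.tendsto_ofReal (hl' i)
  · rw [← ENNReal.ofReal_tsum_of_nonneg
      (fun i => ge_of_tendsto' (hl' i) fun _ => measureReal_nonneg) hl'sum, hl'one,
      ENNReal.ofReal_one]
  · have h1 : Tendsto (fun n => ENNReal.ofReal (1 - (A n).ν.real (unmarked A (combMarks W) n)))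
        atTop (𝓝 1) := by
      simpa using ENNReal.tendsto_ofReal ((tendsto_const_nhds (x := (1 : ℝ))).sub hS0)
    refine h1.congr fun n => ?_
    rw [← hunion, ofReal_measureReal,
      measure_iUnion (combMarks_disjoint hW n) fun _ => MeasurableSet.of_discrete]

variable [L.IsRelational]

theorem localConvergent_combMarks (hA : LocalConvergent A)
    (hW : ∀ i j, i ≠ j → StronglyDisjoint A (W i) (W j))
    (hconv : ∀ j p, ConvergesOn A (W j) p)
    (hneg : ∀ j, Negligible A fun n => boundary L (W j n))
    (hS : Negligible A (unmarked A (combMarks W))) {f : ℕ → ℝ} (hf : Summable f)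
    (hbound : ∀ j n, (A n).ν.real (W j n) ≤ f j) :
    LocalConvergent fun n => (A n).lift fun i => combMarks W i n := by
  rintro p φ ⟨r, hφ⟩
  refine exists_tendsto_of_forall_approx fun ε hε => ?_
  have htail : Tendsto (fun m => (p : ℝ) * ∑' k, f (k + m)) atTop (𝓝 0) := by
    simpa using (tendsto_sum_nat_add f).const_mul (p : ℝ)
  -- The cutoff `m` makes the later clusters weigh less than `ε / 2` even after multiplication by
  -- `p`, and leaves every used mark with index at most `m`.
  obtain ⟨m, hm, hmφ⟩ := ((htail.eventually (gt_mem_nhds (half_pos hε))).and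
    (((usedMarks_finite φ).eventually_all (l := atTop)
      (p := fun i m => i ≤ m)).2 fun i _ => eventually_ge_atTop i)).exists
  let U : Option (Fin m) → SubsetSeq A := fun o =>
    o.elim (fun n => (⋃ j : Fin m, W j n)ᶜ) fun j => W j
  have hUdisj : ∀ n, Pairwise fun i j => Disjoint (U i n) (U j n) := by
    intro n
    have h0 : ∀ j, Disjoint (U none n) (U (some j) n) := fun j =>
      Set.disjoint_left.2 fun x hx hx' => hx (Set.mem_iUnion.2 ⟨j, hx'⟩)
    rintro (_ | i) (_ | j) hij
    · exact absurd rfl hij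
    · exact h0 j
    · exact (h0 i).symm
    · exact pairwise_disjoint_of_stronglyDisjoint hW n
        (fun h => hij (congrArg some (Fin.ext h)))
  have hcover : ∀ n, ⋃ o, U o n = Set.univ := by
    intro n
    refine Set.eq_univ_of_forall fun x => Set.mem_iUnion.2 ?_
    by_cases hx : ∃ j : Fin m, x ∈ W j n
    · obtain ⟨j, hj⟩ := hx
      exact ⟨some j, hj⟩
    · exact ⟨none, fun h => hx (Set.mem_iUnion.1 h)⟩
  have hUneg : ∀ o, Negligible A fun n => boundary L (U o n) := by
    rintro (_ | j)
    · exact (Negligible.boundary_iUnion fun j : Fin m => hneg j).boundary_compl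
    · exact hneg j
  have hUsome : ∀ o, o ≠ none → ∀ p, ConvergesOn A (U o) p := by
    rintro (_ | j) ho
    · exact absurd rfl ho
    · exact hconv j
  have hUconv : ∀ o p, ConvergesOn A (U o) p := by
    intro o
    by_cases ho : o = none
    · subst ho
      exact convergesOn_of_forall_ne A hUdisj hA hcover hUneg none hUsome
    · exact hUsome o ho
  -- Idealised marks: `M_0` on the remainder, `M_(j+1)` on the cluster `W j`.
  let b : ℕ → Option (Fin m) → Prop := fun i o => i = o.elim (0 : ℕ) fun j => (j : ℕ) + 1
  obtain ⟨c, hc, hac⟩ := exists_approx_stone A hUdisj hcover hUconv (combMarks W) hφ b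
  refine ⟨c, hc, ?_⟩
  let e : ℕ → ℝ := fun n => p * (∑ o, (A n).ν.real (ball L (r + 1) (boundary L (U o n))) +
    ((A n).ν.real (ball L r (unmarked A (combMarks W) n)) +
      (A n).ν.real (ball L (r + r) (unmarked A (combMarks W) n))))
  have he : Tendsto e atTop (𝓝 0) := by
    have := ((tendsto_finsetSum Finset.univ fun o _ => (hUneg o).tendsto_real (r + 1)).add
      ((hS.tendsto_real r).add (hS.tendsto_real (r + r)))).const_mul (p : ℝ)
    simpa only [Finset.sum_const_zero, add_zero, mul_zero] using this
  filter_upwards [he.eventually (gt_mem_nhds (half_pos hε))] with n hn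
  refine (hac n).trans ?_
  have htailW : (A n).ν.real (⋃ k, W (k + m) n) ≤ ∑' k, f (k + m) := by
    have hs : Summable fun k => f (k + m) := (summable_nat_add_iff m).2 hf
    have hs' : Summable fun k => (A n).ν.real (W (k + m) n) :=
      hs.of_nonneg_of_le (fun _ => measureReal_nonneg) fun k => hbound _ n
    exact (measureReal_iUnion_le_tsum hs').trans (hs'.tsum_le_tsum (fun k => hbound _ n) hs)
  have hsub : (deepSet L r (fun o => U o n) (fun i => combMarks W i n) b (usedMarks φ))ᶜ ⊆
      (⋃ o, ball L (r + 1) (boundary L (U o n))) ∪ ((ball L r (unmarked A (combMarks W) n) ∪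
        ball L (r + r) (unmarked A (combMarks W) n)) ∪ ⋃ k, W (k + m) n) := by
    refine (compl_deepSet_subset r (hUdisj n) _ _ _).trans (Set.union_subset_union_right _ ?_)
    refine Set.iUnion₂_subset fun i hi => ?_
    have him := hmφ i hi
    rcases i with _ | k
    · have hU0 : (⋃ o ∈ {o | b 0 o}, U o n) = U none n := by
        ext x
        simp [b, Option.exists]
      rw [hU0]
      -- The remainder exceeds `M_0` only by unmarked points and by the discarded clusters.
      have h1 : symmDiff (combMarks W 0 n) (U none n) ⊆
          unmarked A (combMarks W) n ∪ ⋃ k, W (k + m) n := by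
        rintro x (⟨hx, hx'⟩ | ⟨hx, hx'⟩)
        · refine absurd (fun h => hx ?_) hx'
          obtain ⟨j, hj⟩ := Set.mem_iUnion.1 h
          exact subset_ball L 1 _ (Set.mem_iUnion.2 ⟨j, hj⟩)
        · rw [unmarked_combMarks hW]
          simp only [combMarks, Set.notMem_compl_iff, ball_iUnion, Set.mem_iUnion] at hx'
          obtain ⟨j, hj⟩ := hx'
          by_cases hxj : x ∈ W j n
          · have hjm : m ≤ j := by
              by_contra hlt
              exact hx (Set.mem_iUnion.2 ⟨⟨j, not_le.1 hlt⟩, hxj⟩)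
            refine Or.inr (Set.mem_iUnion.2 ⟨j - m, ?_⟩)
            rwa [Nat.sub_add_cancel hjm]
          · exact Or.inl (Set.mem_iUnion.2 ⟨j, hj, hxj⟩)
      refine (ball_mono h1).trans ?_
      rw [ball_union, Set.union_assoc]
      -- The `r`-ball around the discarded clusters costs little: beyond the clusters themselves it
      -- stays within `r + r` of their boundaries, which are unmarked and hence negligible.
      refine Set.union_subset_union_right _ ((ball_subset_union_ball_boundary r _).trans ?_)
      rw [Set.union_comm]
      refine Set.union_subset_union_left _ (ball_mono ((boundary_iUnion_subset _).trans ?_))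
      rw [unmarked_combMarks hW]
      exact Set.iUnion_subset fun k => Set.subset_iUnion (fun j => boundary L (W j n)) (k + m)
    · have hUk : (⋃ o ∈ {o | b (k + 1) o}, U o n) = W k n := by
        ext x
        simp only [Set.mem_iUnion, Set.mem_ofPred_eq, b, exists_prop, Option.exists]
        constructor
        · rintro (⟨h, -⟩ | ⟨j, h, hx⟩)
          · simp at h
          · have : k = j := by simpa using h
            exact this ▸ hx
        · exact fun hx => Or.inr ⟨⟨k, him⟩, rfl, hx⟩
      rw [hUk]
      change ball L r (symmDiff (W k n) (W k n)) ⊆ _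
      rw [symmDiff_self]
      exact (ball_empty r).subset.trans (Set.empty_subset _)
  calc (p : ℝ) * (A n).ν.real
        (deepSet L r (fun o => U o n) (fun i => combMarks W i n) b (usedMarks φ))ᶜ
      ≤ p * ((∑ o, (A n).ν.real (ball L (r + 1) (boundary L (U o n))) +
        (((A n).ν.real (ball L r (unmarked A (combMarks W) n)) +
          (A n).ν.real (ball L (r + r) (unmarked A (combMarks W) n)))) + ∑' k, f (k + m))) := by
        gcongr
        refine (measureReal_mono hsub).trans ((measureReal_union_le _ _).trans ?_)
        refine (add_le_add (measureReal_iUnion_fintype_le _) ((measureReal_union_le _ _).trans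
          (add_le_add (measureReal_union_le _ _) htailW))).trans (add_assoc _ _ _).ge
    _ = e n + p * ∑' k, f (k + m) := mul_add _ _ _
    _ ≤ ε := by linarith

theorem isClustering_combMarks (hA : LocalConvergent A)
    (hW : ∀ i j, i ≠ j → StronglyDisjoint A (W i) (W j))
    (hconv : ∀ j p, ConvergesOn A (W j) p)
    (hneg : ∀ j, Negligible A fun n => boundary L (W j n)) {f g : ℕ → ℝ} (hf : Summable f)
    (hg : Summable g) (hbound : ∀ j n, (A n).ν.real (W j n) ≤ f j)
    (hbound' : ∀ j d n, d ≤ j → (A n).ν.real (ball L d (boundary L (W j n))) ≤ g j) :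
    IsClustering A (combMarks W) :=
  have hS := negligible_unmarked_combMarks hW hneg hg hbound'
  { localConvergent := localConvergent_combMarks hA hW hconv hneg hS hf hbound
    negligible := hS
    boundary_subset := boundary_combMarks_subset hW
    partition := combMarks_disjoint hW
    stable := stable_combMarks hW hS hf hbound fun j => (hconv j 1).exists_tendsto_measure }

end Comb

/-! ### Delaying the clusters to obtain summable bounds. -/

section Truncation

variable {L : FirstOrder.Language.{u, v}} {A : ℕ → ProbStr.{u, v, w} L}

/-- The sequence `X` with all sets before the index `N` replaced by the empty set. -/
def truncate (N : ℕ) (X : SubsetSeq A) : SubsetSeq A := fun n => if N ≤ n then X n else ∅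

theorem truncate_of_le {N n : ℕ} (h : N ≤ n) (X : SubsetSeq A) : truncate N X n = X n := if_pos h

theorem truncate_of_not_le {N n : ℕ} (h : ¬ N ≤ n) (X : SubsetSeq A) : truncate N X n = ∅ :=
  if_neg h

theorem truncate_eventuallyEq (N : ℕ) (X : SubsetSeq A) : ∀ᶠ n in atTop, truncate N X n = X n :=
  (eventually_ge_atTop N).mono fun _ h => truncate_of_le h X

theorem StronglyDisjoint.truncate {X Y : SubsetSeq A} (h : StronglyDisjoint A X Y) (N N' : ℕ) :
    StronglyDisjoint A (truncate N X) (truncate N' Y) := by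
  intro n
  have hX : ClusterComb.truncate N X n ⊆ X n := by
    unfold ClusterComb.truncate; split_ifs <;> simp
  have hY : ClusterComb.truncate N' Y n ⊆ Y n := by
    unfold ClusterComb.truncate; split_ifs <;> simp
  rw [← Set.subset_empty_iff, ← h n]
  exact Set.union_subset_union (Set.inter_subset_inter (ball_mono hX) hY)
    (Set.inter_subset_inter hX (ball_mono hY))

theorem Negligible.boundary_truncate {X : SubsetSeq A}
    (h : Negligible A fun n => boundary L (X n)) (N : ℕ) :
    Negligible A fun n => boundary L (truncate N X n) := fun d =>
  (h d).congr' ((truncate_eventuallyEq N X).mono fun n hn => by beta_reduce; rw [hn])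

theorem equivalent_truncate (N : ℕ) (X : SubsetSeq A) : Equivalent A (truncate N X) X := fun d =>
  tendsto_const_nhds.congr' ((truncate_eventuallyEq N X).mono fun n hn => by
    have : symmDiff (X n) (X n) = ∅ := symmDiff_self _
    beta_reduce; rw [hn, this, ball_empty, measure_empty])

theorem ConvergesOn.truncate [L.IsRelational] {X : SubsetSeq A} {p : ℕ} (h : ConvergesOn A X p)
    (N : ℕ) : ConvergesOn A (truncate N X) p := by
  intro φ hφ
  obtain ⟨l, hl⟩ := h φ hφ
  exact ⟨l, hl.congr' ((truncate_eventuallyEq N X).mono fun n hn => by beta_reduce; rw [hn])⟩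

/-- Finite sums of the limits are limits of measures of disjoint unions, hence at most `1`. -/
theorem summable_of_tendsto_measureReal {X : ℕ → SubsetSeq A}
    (hX : ∀ n, Pairwise fun i j => Disjoint (X i n) (X j n)) {l : ℕ → ℝ}
    (hl : ∀ j, Tendsto (fun n => (A n).ν.real (X j n)) atTop (𝓝 (l j))) : Summable l := by
  refine summable_of_sum_le (fun j => ge_of_tendsto' (hl j) fun _ => measureReal_nonneg) (c := 1)
    fun s => le_of_tendsto' (tendsto_finsetSum s fun j _ => hl j) fun n => ?_
  rw [← measureReal_biUnion_finset ((hX n).set_pairwise _) fun _ _ => MeasurableSet.of_discrete]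
  exact measureReal_le_one

theorem exists_isClustering_truncate [L.IsRelational] (hA : LocalConvergent A)
    {D : ℕ → SubsetSeq A} (hD : ∀ j, IsCluster A (D j))
    (hdisj : ∀ i j, i ≠ j → StronglyDisjoint A (D i) (D j)) :
    ∃ H : ℕ → ℕ, Monotone H ∧ Tendsto H atTop atTop ∧
      IsClustering A (combMarks fun j => truncate (H j) (D j)) := by
  choose l hl using fun j => ((hD j).convergesOn 1).exists_tendsto_measure
  -- The radius grows with the index `j`, so for each fixed radius all but finitely many clusters
  -- obey the geometric bound.
  have hN : ∀ j, ∃ N, ∀ n ≥ N, (A n).ν.real (D j n) ≤ l j + (1 / 2) ^ j ∧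
      (A n).ν.real (ball L j (boundary L (D j n))) ≤ (1 / 2) ^ j := fun j =>
    eventually_atTop.1 (((hl j).eventually_le_const (by simp)).and
      (((hD j).2.tendsto_real j).eventually_le_const (by positivity)))
  choose N hN using hN
  -- The partial sums dominate each `N j` and are monotone; the summand `j` forces divergence.
  let H : ℕ → ℕ := fun j => ∑ k ∈ Finset.range (j + 1), N k + j
  have hNH : ∀ j, N j ≤ H j := fun j =>
    (Finset.single_le_sum (f := N) (fun _ _ => Nat.zero_le _)
      (Finset.self_mem_range_succ j)).trans (Nat.le_add_right _ _)
  have hHmono : Monotone H := fun i j hij => by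
    refine Nat.add_le_add (Finset.sum_le_sum_of_subset ?_) hij
    exact Finset.range_mono (Nat.succ_le_succ hij)
  refine ⟨H, hHmono, tendsto_atTop_mono (fun j => Nat.le_add_left _ _) tendsto_id, ?_⟩
  have hl0 : ∀ j, 0 ≤ l j := fun j => ge_of_tendsto' (hl j) fun _ => measureReal_nonneg
  refine isClustering_combMarks (f := fun j => l j + (1 / 2) ^ j) (g := fun j => (1 / 2) ^ j) hA
    (fun i j hij => (hdisj i j hij).truncate _ _) (fun j p => ((hD j).convergesOn p).truncate _)
    (fun j => (hD j).2.boundary_truncate _)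
    ((summable_of_tendsto_measureReal (pairwise_disjoint_of_stronglyDisjoint hdisj) hl).add
      summable_geometric_two) summable_geometric_two ?_ ?_
  · intro j n
    by_cases h : H j ≤ n
    · rw [truncate_of_le h]
      exact (hN j n ((hNH j).trans h)).1
    · rw [truncate_of_not_le h, measureReal_empty]
      have := hl0 j
      positivity
  · intro j d n hd
    by_cases h : H j ≤ n
    · rw [truncate_of_le h]
      exact (measureReal_mono (ball_mono_radius hd _)).trans (hN j n ((hNH j).trans h)).2
    · rw [truncate_of_not_le h, boundary_empty, ball_empty, measureReal_empty]
      positivity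

end Truncation

end ClusterComb

theorem mainTheorem4 {L : FirstOrder.Language.{u, v}} [L.IsRelational]
    (A : ℕ → ClusterComb.ProbStr.{u, v, w} L) (hA : ClusterComb.LocalConvergent A)
    (C : ℕ → ClusterComb.SubsetSeq A)
    (hC : ∀ i, 1 ≤ i → ClusterComb.IsCluster A (C i))
    (hdisj : ∀ i j, 1 ≤ i → 1 ≤ j → i ≠ j → ClusterComb.StronglyDisjoint A (C i) (C j)) :
    ∃ M : ℕ → ClusterComb.SubsetSeq A,
      ClusterComb.IsClustering A M ∧
      (∃ G : ℕ → ℕ, Monotone G ∧ Tendsto G atTop atTop ∧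
        ∀ i, 1 ≤ i → ∀ n, (G i ≤ n → M i n = C i n) ∧ (¬ G i ≤ n → M i n = ∅)) ∧
      ∀ i, 1 ≤ i → ClusterComb.Equivalent A (M i) (C i) := by
  obtain ⟨H, hmono, hlim, hclus⟩ := ClusterComb.exists_isClustering_truncate hA
    (D := fun j => C (j + 1)) (fun j => hC _ (Nat.le_add_left 1 j))
    (fun i j hij => hdisj _ _ (Nat.le_add_left 1 i) (Nat.le_add_left 1 j) (by simpa using hij))
  -- Clusters are indexed from `1`, so `G` is `H` shifted by one; the value `0` at index `0` is a
  -- harmless choice preserving monotonicity.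
  refine ⟨_, hclus, ⟨fun i => Nat.casesOn i 0 H, ?_, ?_, ?_⟩, ?_⟩
  · exact monotone_nat_of_le_succ fun i => by
      rcases i with _ | i
      · exact Nat.zero_le _
      · exact hmono (Nat.le_succ i)
  · exact (tendsto_add_atTop_iff_nat 1).1 hlim
  · rintro (_ | i) hi n
    · exact absurd hi (by simp)
    · exact ⟨fun h => ClusterComb.truncate_of_le h _, fun h => ClusterComb.truncate_of_not_le h _⟩
  · rintro (_ | i) hi
    · exact absurd hi (by simp)
    · exact ClusterComb.equivalent_truncate _ _
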